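/- Let $k$ be a field of characteristic $0$, $K/k$ a finitely generated field extension, $X=\mathbb P^1_K$. All absolute differentials are over $k$: $\Omega^1_X=\Omega^1_{X/k}$, $\Omega^1_K=\Omega^1_{K/k}$; relative forms are $\omega=\omega_{X/K}$. Let $\mathcal D=\sum_i m_i x_i$ be an effective divisor ($m_i\ge 1$) with distinct $x_i\in X(K)$, and $U=X\setminus\{x_i\}$. Let $\Omega^1_X\{\mathcal D\}\subset\Omega^1_X(\mathcal D)$ be the sheaf of forms that are regular on $U$ and of the shape $f\frac{dz}{z^{m_i}}+\frac{\eta}{z^{m_i-1}}$ at $x_i$, with $z$ a local parameter at $x_i$, $f\in\mathcal O_{X,x_i}$ and $\eta\in\mathcal O_{X,x_i}\otimes_K\Omega^1_K$. A connection $\nabla$ on the restriction to $U$ of a vector bundle $E$ of rank $r$ on $X$ is taken over $k$ (functions in $K$ are also differentiated). It is assumed to be vertical, i.e. $\nabla^2(E)\subset E(*D)\otimes\Omega^2_K$, with $D=\sum_i x_i$. Write $\nabla_{/K}$ for the induced relative connection. For such a pair $(E,\nabla)$, define the following local conditions. * $(E,\nabla)$ is *admissible at* $x_i$ if near $x_i$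 it takes values in $E\otimes\Omega^1_X\{\mathcal D\}$ and: if $m_i\ge2$, the relative polar part $E/\mathfrak m_{x_i}^{m_i}E\to \big(E\otimes\omega(m_ix_i)\big)/\big(E\otimes\omega\big)$ (stalks at $x_i$) induced by $\nabla_{/K}$ is an isomorphism; if $m_i=1$, no eigenvalue of the residue of $\nabla_{/K}$ at $x_i$ lies in $\{0,1,2,\dots\}$. It is *admissible* if it is so at every $x_i$. * $(E,\nabla)$ is *pseudo-logarithmic at* $x_i$ (where $m_i=1$) if in some local basis of $E$ its matrix is $g\frac{dz}{z}+\frac{\eta}{z}$ with $z$ a local parameter, $g\in GL_r(\mathcal O_{X,x_i})$, and $\eta$ a matrix with entries in $\mathcal O_{X,x_i}\otimes_K\Omega^1_K$. * It is *special pseudo-logarithmic at* $x_i$ if it is pseudo-logarithmic there and, in some local basis and for some local parameter $z$, its matrix has the block shape $$\begin{pmatrix}A+m\frac{dz}{z}& zB\\ \frac{C}{z}& D'+n\frac{dz}{z}\end{pmatrix}$$ with $A,B,C,D'$ matrices with entries in $\Omega^1_{X,x_i}$ and $m,n\in k$. * $(E,\nabla)$ is *special pseudo-admissible* if it is admissible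 at every $x_i$ with $m_i\ge2$, pseudo-logarithmic at every $x_i$ with $m_i=1$, and at each $x_i$ with $m_i=1$ it is admissible or special pseudo-logarithmic. **Theorem 2.1.** Let $(E,\nabla)$ be an admissible (vertical) connection on $\mathbb P^1_K$ with singularities $\mathcal D$, such that $m_i\ge2$ for at least one $i$. Then there are finitely many points $p_j\in U(K)$ such that, with $\lambda:V=U\setminus\{p_j\}\hookrightarrow\mathbb P^1_K$ and $\mathcal D'=\mathcal D+\sum_j p_j$, the connection $(E|_V,\nabla|_V)$ extends to a special pseudo-admissible connection $(L,\nabla)$, $L\cong\bigoplus_1^r\mathcal O_{\mathbb P^1_K}$, with singularities $\mathcal D'$, and the inclusion of complexes of sheaves on $\mathbb P^1_K$ $$\Big(L\xrightarrow{\nabla_{/K}}\omega(\mathcal D')\otimes L\Big)\longrightarrow\Big(\lambda_*E_V\xrightarrow{\nabla_{/K}}\lambda_*(\omega\otimes E_V)\Big)$$ is a quasi-isomorphism, where $E_V=E|_V$. -/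

import Mathlib

open Polynomial TensorProduct WithZero
open scoped KaehlerDifferential

namespace P1Conn

noncomputable section

/-! ### The projective line `ℙ¹_K`, through its function field `K(t)` -/

/-- Closed points of `ℙ¹_K`: the closed points of `𝔸¹_K = Spec K[t]`, and the point `∞`. -/
abbrev ClosedPoint (K : Type*) [Field K] : Type _ :=
  Option (IsDedekindDomain.HeightOneSpectrum K[X])

open Classical in
/-- The (multiplicative) valuation of `K(t)` at a closed point; `val x f = exp (-n)` means that
`f` vanishes to order exactly `n` at `x`. -/
def val {K : Type*} [Field K] : ClosedPoint K → Valuation (RatFunc K) ℤᵐ⁰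
  | some v => v.valuation (RatFunc K)
  | none => RatFunc.inftyValuation K

/-- The local ring `𝒪_{ℙ¹,x}` inside `K(t)`. -/
def localRing {K : Type*} [Field K] (x : ClosedPoint K) : Subring (RatFunc K) :=
  (val x).integer

/-- `z` is a local parameter at `x`. -/
def IsParam {K : Type*} [Field K] (x : ClosedPoint K) (z : RatFunc K) : Prop :=
  val x z = exp (-1 : ℤ)

/-- `x` is a `K`-rational point: the residue field of `𝒪_x` is `K`. -/
def IsRational {K : Type*} [Field K] (x : ClosedPoint K) : Prop :=
  ∀ f ∈ localRing x, ∃ c : K, val x (f - RatFunc.C c) < 1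

/-- An effective divisor `𝒟 = ∑ mᵢ xᵢ` on `ℙ¹_K`. -/
abbrev EffDivisor (K : Type*) [Field K] : Type _ := ClosedPoint K →₀ ℕ

section Stalks

variable {K : Type*} [Field K] (x : ClosedPoint K)
  {M : Type*} [AddCommGroup M] [Module (RatFunc K) M]
  {V : Type*} [AddCommGroup V] [Module (RatFunc K) V]

/-- For a lattice `S` over `𝒪_x` this is `S(n x) = 𝔪_x^{-n} S`, `n ∈ ℤ`. -/
def twist (n : ℤ) (S : Submodule (localRing x) M) : Submodule (localRing x) M :=
  Submodule.span (localRing x) {m | ∃ g : RatFunc K, val x g ≤ exp n ∧ ∃ s ∈ S, m = g • s}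

/-- The tensor product over `𝒪_x` of two `𝒪_x`-lattices, inside the tensor product over `K(t)` of
the ambient spaces. -/
def tens (S : Submodule (localRing x) M) (T : Submodule (localRing x) V) :
    Submodule (localRing x) (M ⊗[RatFunc K] V) :=
  Submodule.span (localRing x) {m | ∃ s ∈ S, ∃ e ∈ T, m = s ⊗ₜ[RatFunc K] e}

/-- The stalk at `x` of the sheaf of regular differentials over the base field `k`: the
`𝒪_x`-module generated by `df`, `f ∈ 𝒪_x`, inside the Kähler differentials of `K(t)` over `k`.
For a subfield `k` of `K` these are the absolute forms `Ω¹_X`; for `k = K` these are the relative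
forms `ω_{X/K}`. -/
def regForms (k : Type*) [Field k] [Algebra k (RatFunc K)] :
    Submodule (localRing x) Ω[RatFunc K⁄k] :=
  Submodule.span (localRing x)
    {w | ∃ f ∈ localRing x, w = KaehlerDifferential.D k (RatFunc K) f}

/-- The stalk at `x` of `𝒪_X ⊗_K Ω¹_K ⊆ Ω¹_X`. -/
def constForms (k : Type*) [Field k] [Algebra k (RatFunc K)] :
    Submodule (localRing x) Ω[RatFunc K⁄k] :=
  Submodule.span (localRing x)
    {w | ∃ c : K, w = KaehlerDifferential.D k (RatFunc K) (RatFunc.C c)}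

/-- The stalk at `x` of `Ω¹_X{𝒟}`, where `x` has multiplicity `m` in `𝒟`: the forms
`f dz / z^m + η / z^(m-1)` with `f ∈ 𝒪_x`, `η ∈ 𝒪_x ⊗ Ω¹_K` if `m ≥ 1`, and the regular forms if
`m = 0`. -/
def curlyForms (k : Type*) [Field k] [Algebra k (RatFunc K)] (m : ℕ) :
    Submodule (localRing x) Ω[RatFunc K⁄k] :=
  if m = 0 then regForms x k else
    Submodule.span (localRing x)
      {w | ∃ z, IsParam x z ∧ ∃ f ∈ localRing x, ∃ η ∈ constForms x k,
        w = (f / z ^ m) • KaehlerDifferential.D k (RatFunc K) z + (z ^ (m - 1))⁻¹ • η}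

end Stalks

/-! ### Vector bundles on `ℙ¹_K` -/

/-- A vector bundle on `ℙ¹_K` with generic fibre `V`: a free `𝒪_x`-lattice in `V` for every closed
point `x`, such that some basis of `V` generates all but finitely many of these. Its sections over
an open set `W` are `⋂_{x ∈ W} E_x`. -/
structure VecBundle (K : Type*) [Field K] (V : Type*) [AddCommGroup V] [Module (RatFunc K) V] where
  /-- The stalk at a closed point. -/
  stalk : (x : ClosedPoint K) → Submodule (localRing x) V
  locallyFree : ∀ x, ∃ b : Module.Basis (Fin (Module.finrank (RatFunc K) V)) (RatFunc K) V,
    stalk x = Submodule.span (localRing x) (Set.range b)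
  coherent : ∃ b : Module.Basis (Fin (Module.finrank (RatFunc K) V)) (RatFunc K) V,
    {x | stalk x ≠ Submodule.span (localRing x) (Set.range b)}.Finite

/-- The bundle is isomorphic to `𝒪_{ℙ¹}^{⊕ r}`: it has a global frame. -/
def VecBundle.IsTrivial {K : Type*} [Field K] {V : Type*} [AddCommGroup V] [Module (RatFunc K) V]
    (E : VecBundle K V) : Prop :=
  ∃ b : Module.Basis (Fin (Module.finrank (RatFunc K) V)) (RatFunc K) V,
    ∀ x, E.stalk x = Submodule.span (localRing x) (Set.range b)

/-! ### The exterior derivative and the curvature -/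

section Exterior

variable (k F : Type*) [Field k] [Field F] [Algebra k F]

/-- `∑ a [b] ↦ ∑ da ∧ db`. -/
def extDerivAux : (F →₀ F) →+ ExteriorAlgebra F Ω[F⁄k] :=
  Finsupp.liftAddHom fun b =>
    (AddMonoidHom.mulRight (ExteriorAlgebra.ι F (KaehlerDifferential.D k F b))).comp
      ((ExteriorAlgebra.ι F).toAddMonoidHom.comp
        ((KaehlerDifferential.D k F).toLinearMap.toAddMonoidHom))

@[simp] lemma extDerivAux_single (a b : F) :
    extDerivAux k F (Finsupp.single b a) =
      ExteriorAlgebra.ι F (KaehlerDifferential.D k F a) *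
        ExteriorAlgebra.ι F (KaehlerDifferential.D k F b) := by
  simp [extDerivAux]

lemma extDerivAux_smul (c : F) (u : F →₀ F) :
    extDerivAux k F (c • u) =
      ExteriorAlgebra.ι F (KaehlerDifferential.D k F c) *
        ExteriorAlgebra.ι F (Finsupp.linearCombination F (KaehlerDifferential.D k F) u)
      + c • extDerivAux k F u := by
  induction u using Finsupp.induction_linear with
  | zero => simp
  | add u v hu hv => simp only [smul_add, map_add, hu, hv, mul_add]; abel
  | single b a =>
    simp only [Finsupp.smul_single, smul_eq_mul, extDerivAux_single, Derivation.leibniz, map_add,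
      map_smul, add_mul, Finsupp.linearCombination_single, mul_smul_comm, smul_mul_assoc]
    abel

lemma ι_mul_swap (a b : Ω[F⁄k]) :
    ExteriorAlgebra.ι F a * ExteriorAlgebra.ι F b =
      -(ExteriorAlgebra.ι F b * ExteriorAlgebra.ι F a) :=
  eq_neg_of_add_eq_zero_left (ExteriorAlgebra.ι_add_mul_swap a b)

lemma extDerivAux_ker :
    ((Finsupp.linearCombination F (KaehlerDifferential.D k F)).toAddMonoidHom).ker ≤
      (extDerivAux k F).ker := by
  intro u hu
  have hu' : u ∈ KaehlerDifferential.kerTotal k F := by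
    rw [← KaehlerDifferential.kerTotal_eq]
    exact hu
  have key : Finsupp.linearCombination F (KaehlerDifferential.D k F) u = 0 ∧
      extDerivAux k F u = 0 := by
    clear hu
    unfold KaehlerDifferential.kerTotal at hu'
    induction hu' using Submodule.span_induction with
    | mem u h =>
      rcases h with (⟨⟨a, b⟩, rfl⟩ | ⟨⟨a, b⟩, rfl⟩) | ⟨c, rfl⟩
      · simp
      · simp [ι_mul_swap k F (KaehlerDifferential.D k F b) (KaehlerDifferential.D k F a)]
      · simp
    | zero => simp
    | add u v _ _ hu hv => simp [hu.1, hu.2, hv.1, hv.2]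
    | smul c u _ hu =>
      refine ⟨by simp [hu.1], ?_⟩
      rw [extDerivAux_smul, hu.1, hu.2]
      simp
  exact key.2

/-- The exterior derivative `d : Ω¹_F → Ω²_F`, characterised by `d (a db) = da ∧ db`. It takes its
values in the degree two part of the exterior algebra. -/
def extDeriv : Ω[F⁄k] →+ ExteriorAlgebra F Ω[F⁄k] :=
  (Finsupp.linearCombination F (KaehlerDifferential.D k F)).toAddMonoidHom.liftOfSurjective
    (KaehlerDifferential.linearCombination_surjective k F)
    ⟨extDerivAux k F, extDerivAux_ker k F⟩

lemma extDeriv_linearCombination (u : F →₀ F) :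
    extDeriv k F (Finsupp.linearCombination F (KaehlerDifferential.D k F) u) =
      extDerivAux k F u :=
  AddMonoidHom.liftOfRightInverse_comp_apply _ _ _
    ⟨extDerivAux k F, extDerivAux_ker k F⟩ u

lemma extDeriv_smul (c : F) (w : Ω[F⁄k]) :
    extDeriv k F (c • w) =
      ExteriorAlgebra.ι F (KaehlerDifferential.D k F c) * ExteriorAlgebra.ι F w
        + c • extDeriv k F w := by
  obtain ⟨u, rfl⟩ := KaehlerDifferential.linearCombination_surjective k F w
  rw [← map_smul, extDeriv_linearCombination, extDeriv_linearCombination, extDerivAux_smul]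

lemma extDeriv_smul_D (a b : F) :
    extDeriv k F (a • KaehlerDifferential.D k F b) =
      ExteriorAlgebra.ι F (KaehlerDifferential.D k F a) *
        ExteriorAlgebra.ι F (KaehlerDifferential.D k F b) := by
  have h := extDeriv_linearCombination k F (Finsupp.single b a)
  simpa using h

end Exterior

/-- An absolute connection on the generic fibre `V` (a `k`-linear map, since the Leibniz rule and
`dc = 0` for `c ∈ k` imply `∇ (c v) = c ∇ v`). -/
structure Connection (k K : Type*) [Field k] [Field K] [Algebra k K]
    (V : Type*) [AddCommGroup V] [Module (RatFunc K) V] where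
  toHom : V →+ Ω[RatFunc K⁄k] ⊗[RatFunc K] V
  leibniz : ∀ (f : RatFunc K) (v : V),
    toHom (f • v) = KaehlerDifferential.D k (RatFunc K) f ⊗ₜ[RatFunc K] v + f • toHom v

section Connections

variable {k K : Type*} [Field k] [Field K] [Algebra k K]
  {V : Type*} [AddCommGroup V] [Module (RatFunc K) V]

/-- `ξ ↦ w ∧ ξ`, for a 1-form `w` and a `V`-valued 1-form `ξ`. -/
def wedge (w : Ω[RatFunc K⁄k]) :
    Ω[RatFunc K⁄k] ⊗[RatFunc K] V →ₗ[RatFunc K]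
      ExteriorAlgebra (RatFunc K) Ω[RatFunc K⁄k] ⊗[RatFunc K] V :=
  LinearMap.rTensor V
    ((LinearMap.mulLeft (RatFunc K) (ExteriorAlgebra.ι (RatFunc K) w)).comp
      (ExteriorAlgebra.ι (RatFunc K)))

@[simp] lemma wedge_tmul (w w' : Ω[RatFunc K⁄k]) (v : V) :
    wedge w (w' ⊗ₜ[RatFunc K] v) =
      (ExteriorAlgebra.ι (RatFunc K) w * ExteriorAlgebra.ι (RatFunc K) w') ⊗ₜ[RatFunc K] v := by
  simp [wedge]

lemma wedge_add (w w' : Ω[RatFunc K⁄k]) (ξ : Ω[RatFunc K⁄k] ⊗[RatFunc K] V) :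
    wedge (w + w') ξ = wedge w ξ + wedge w' ξ := by
  induction ξ using TensorProduct.induction_on with
  | zero => simp
  | tmul a v => simp [add_mul, TensorProduct.add_tmul]
  | add a b ha hb => simp only [map_add, ha, hb]; abel

lemma wedge_smul (f : RatFunc K) (w : Ω[RatFunc K⁄k]) (ξ : Ω[RatFunc K⁄k] ⊗[RatFunc K] V) :
    wedge (f • w) ξ = f • wedge w ξ := by
  induction ξ using TensorProduct.induction_on with
  | zero => simp
  | tmul a v => simp [TensorProduct.smul_tmul']
  | add a b ha hb => simp only [map_add, ha, hb, smul_add]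

/-- The map `w ⊗ v ↦ dw ⊗ v - w ∧ ∇v` on `V`-valued 1-forms. -/
def Connection.extend (N : Connection k K V) :
    Ω[RatFunc K⁄k] ⊗[RatFunc K] V →+
      ExteriorAlgebra (RatFunc K) Ω[RatFunc K⁄k] ⊗[RatFunc K] V :=
  TensorProduct.liftAddHom
    (AddMonoidHom.mk'
      (fun w => AddMonoidHom.mk'
        (fun v => extDeriv k (RatFunc K) w ⊗ₜ[RatFunc K] v - wedge w (N.toHom v))
        (fun v v' => by simp only [TensorProduct.tmul_add, map_add]; abel))
      (fun w w' => by
        ext v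
        simp only [AddMonoidHom.mk'_apply, map_add, TensorProduct.add_tmul, wedge_add,
          AddMonoidHom.add_apply]
        abel))
    (fun f w v => by
      simp only [AddMonoidHom.mk'_apply, extDeriv_smul, N.leibniz, map_add, map_smul, wedge_smul,
        wedge_tmul, TensorProduct.add_tmul, TensorProduct.smul_tmul, TensorProduct.tmul_smul]
      rw [ι_mul_swap k (RatFunc K) w, TensorProduct.neg_tmul]
      abel)

lemma Connection.extend_tmul (N : Connection k K V) (w : Ω[RatFunc K⁄k]) (v : V) :
    N.extend (w ⊗ₜ[RatFunc K] v) =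
      extDeriv k (RatFunc K) w ⊗ₜ[RatFunc K] v - wedge w (N.toHom v) := rfl

/-- The curvature `∇² : V → Ω² ⊗ V`. -/
def Connection.curvature (N : Connection k K V) :
    V →+ ExteriorAlgebra (RatFunc K) Ω[RatFunc K⁄k] ⊗[RatFunc K] V :=
  N.extend.comp N.toHom

/-- The relative connection `∇_{/K}`. -/
def Connection.rel (N : Connection k K V) : V →+ Ω[RatFunc K⁄K] ⊗[RatFunc K] V :=
  (LinearMap.rTensor V
    (KaehlerDifferential.map k K (RatFunc K) (RatFunc K))).toAddMonoidHom.comp N.toHom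

/-- Verticality: `∇²` maps `E` to `E(*D) ⊗ Ω²_K`, where `D` is the support of `𝒟`. As
`E(*D) = j_* (E|_U)` for the open embedding `j` of `U = ℙ¹ ∖ D`, this is a condition at the points
of `U`. -/
def IsVertical (E : VecBundle K V) (N : Connection k K V) (𝒟 : EffDivisor K) : Prop :=
  ∀ x, 𝒟 x = 0 → ∀ e ∈ E.stalk x, N.curvature e ∈
    Submodule.span (localRing x)
      {u | ∃ c c' : K, ∃ e' ∈ E.stalk x,
        u = (ExteriorAlgebra.ι (RatFunc K)
              (KaehlerDifferential.D k (RatFunc K) (RatFunc.C c)) *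
            ExteriorAlgebra.ι (RatFunc K)
              (KaehlerDifferential.D k (RatFunc K) (RatFunc.C c'))) ⊗ₜ[RatFunc K] e'}

/-- Locally at `x`, `∇` maps `E` to `E ⊗ Ω¹_X{𝒟}`, where `m` is the multiplicity of `x` in `𝒟`. -/
def HasPolesAt (E : VecBundle K V) (N : Connection k K V) (x : ClosedPoint K) (m : ℕ) : Prop :=
  ∀ e ∈ E.stalk x, N.toHom e ∈ tens x (curlyForms x k m) (E.stalk x)

/-- The stalk at `x` of `E ⊗ ω_{X/K}(m x)`. -/
def relForms (E : VecBundle K V) (x : ClosedPoint K) (m : ℕ) :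
    Submodule (localRing x) (Ω[RatFunc K⁄K] ⊗[RatFunc K] V) :=
  tens x (twist x m (regForms x K)) (E.stalk x)

/-- The relative polar part map `E_x / 𝔪_x^m E_x → (E ⊗ ω_{X/K}(m x))_x / (E ⊗ ω_{X/K})_x` induced
by `∇_{/K}` is an isomorphism: its kernel is trivial and it is onto. -/
def PolarPartIso (E : VecBundle K V) (N : Connection k K V) (x : ClosedPoint K) (m : ℕ) : Prop :=
  (∀ e ∈ E.stalk x, N.rel e ∈ relForms E x 0 → e ∈ twist x (-m) (E.stalk x)) ∧
    ∀ ξ ∈ relForms E x m, ∃ e ∈ E.stalk x, ξ - N.rel e ∈ relForms E x 0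

/-- At a point `x` with `∇_{/K} E_x ⊆ (E ⊗ ω_{X/K}(x))_x`: no eigenvalue of the residue of
`∇_{/K}`, an endomorphism of the fibre `E_x / 𝔪_x E_x`, lies in `{0, 1, 2, …}`. -/
def DeligneCondition (E : VecBundle K V) (N : Connection k K V) (x : ClosedPoint K) : Prop :=
  ∀ z, IsParam x z → ∀ n : ℕ, ∀ e ∈ E.stalk x,
    N.rel e - ((n : RatFunc K) * z⁻¹) •
        (KaehlerDifferential.D K (RatFunc K) z ⊗ₜ[RatFunc K] e) ∈ relForms E x 0 →
      e ∈ twist x (-1) (E.stalk x)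

/-- `(E, ∇)` is admissible at a singular point `x` of multiplicity `m ≥ 1`. -/
def IsAdmissibleAt (E : VecBundle K V) (N : Connection k K V) (x : ClosedPoint K) (m : ℕ) : Prop :=
  HasPolesAt E N x m ∧ (2 ≤ m → PolarPartIso E N x m) ∧ (m = 1 → DeligneCondition E N x)

/-- `A` is the matrix of `∇` in the basis `b`: `∇ b_j = ∑_i A_{ij} ⊗ b_i`. -/
def HasMatrix {ι : Type*} [Fintype ι] (N : Connection k K V)
    (b : Module.Basis ι (RatFunc K) V) (A : Matrix ι ι Ω[RatFunc K⁄k]) : Prop :=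
  ∀ j, N.toHom (b j) = ∑ i, A i j ⊗ₜ[RatFunc K] b i

/-- `(E, ∇)` is pseudo-logarithmic at `x`: in some local basis its matrix is `g dz/z + η/z` with
`g ∈ GL_r(𝒪_x)` and `η` a matrix over `𝒪_x ⊗ Ω¹_K`. -/
def IsPseudoLogAt (E : VecBundle K V) (N : Connection k K V) (x : ClosedPoint K) : Prop :=
  ∃ z, IsParam x z ∧
    ∃ b : Module.Basis (Fin (Module.finrank (RatFunc K) V)) (RatFunc K) V,
      E.stalk x = Submodule.span (localRing x) (Set.range b) ∧
      ∃ (g : Matrix.GeneralLinearGroup (Fin (Module.finrank (RatFunc K) V)) (localRing x))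
        (η : Matrix (Fin (Module.finrank (RatFunc K) V)) (Fin (Module.finrank (RatFunc K) V))
          Ω[RatFunc K⁄k]),
        (∀ i j, η i j ∈ constForms x k) ∧
        HasMatrix N b (Matrix.of fun i j =>
          ((g.1 i j : RatFunc K) * z⁻¹) • KaehlerDifferential.D k (RatFunc K) z + z⁻¹ • η i j)

/-- `(E, ∇)` is special pseudo-logarithmic at `x`: it is pseudo-logarithmic, and in some local
basis its matrix consists of the blocks `A + m dz/z`, `z B`, `C/z`, `D + n dz/z` with
`A`, `B`, `C`, `D` regular and `m`, `n ∈ k`. -/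
def IsSpecialPseudoLogAt (E : VecBundle K V) (N : Connection k K V) (x : ClosedPoint K) : Prop :=
  IsPseudoLogAt E N x ∧
  ∃ z, IsParam x z ∧ ∃ (p q : ℕ) (b : Module.Basis (Fin p ⊕ Fin q) (RatFunc K) V),
    E.stalk x = Submodule.span (localRing x) (Set.range b) ∧
    ∃ (A : Matrix (Fin p) (Fin p) Ω[RatFunc K⁄k]) (B : Matrix (Fin p) (Fin q) Ω[RatFunc K⁄k])
      (C : Matrix (Fin q) (Fin p) Ω[RatFunc K⁄k]) (D : Matrix (Fin q) (Fin q) Ω[RatFunc K⁄k])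
      (m n : k),
      (∀ i j, Matrix.fromBlocks A B C D i j ∈ regForms x k) ∧
      HasMatrix N b (Matrix.fromBlocks
        (A + Matrix.diagonal fun _ => m • z⁻¹ • KaehlerDifferential.D k (RatFunc K) z)
        (z • B) (z⁻¹ • C)
        (D + Matrix.diagonal fun _ => n • z⁻¹ • KaehlerDifferential.D k (RatFunc K) z))

/-- `(E, ∇)` is a vertical connection on `ℙ¹_K` that is regular outside the support of `𝒟`, which
consists of `K`-rational points. The behaviour at the points of `𝒟` is not restricted here. -/
structure IsVerticalConnection (E : VecBundle K V) (N : Connection k K V) (𝒟 : EffDivisor K) :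
    Prop where
  rational : ∀ x, 𝒟 x ≠ 0 → IsRational x
  regular : ∀ x, 𝒟 x = 0 → HasPolesAt E N x 0
  vertical : IsVertical E N 𝒟

/-- `(E, ∇)` is an admissible connection on `ℙ¹_K` with singularities `𝒟`. -/
structure IsAdmissible (E : VecBundle K V) (N : Connection k K V) (𝒟 : EffDivisor K) : Prop
    extends IsVerticalConnection E N 𝒟 where
  admissible : ∀ x, 𝒟 x ≠ 0 → IsAdmissibleAt E N x (𝒟 x)

/-- `(E, ∇)` is a pseudo-admissible connection on `ℙ¹_K` with singularities `𝒟`. -/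
structure IsPseudoAdmissible (E : VecBundle K V) (N : Connection k K V) (𝒟 : EffDivisor K) : Prop
    extends IsVerticalConnection E N 𝒟 where
  admissible : ∀ x, 2 ≤ 𝒟 x → IsAdmissibleAt E N x (𝒟 x)
  pseudoLog : ∀ x, 𝒟 x = 1 → IsPseudoLogAt E N x

/-- `(E, ∇)` is special pseudo-admissible: it is pseudo-admissible, and each singular point of
multiplicity one is an admissible or a special pseudo-logarithmic point. -/
structure IsSpecialPseudoAdmissible (E : VecBundle K V) (N : Connection k K V) (𝒟 : EffDivisor K) :
    Prop extends IsPseudoAdmissible E N 𝒟 where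
  special : ∀ x, 𝒟 x = 1 → IsAdmissibleAt E N x 1 ∨ IsSpecialPseudoLogAt E N x

end Connections

/-! ### Quasi-isomorphisms -/

/-- The stalk at `x` of `λ_* (𝓕|_W)`, for the embedding `λ` of an open set `W` of `ℙ¹_K` and the
sheaf `𝓕` with stalks `S y ⊆ M` (whose sections over an open set are the elements of `M` that lie
in the stalk at each of its points): the union, over the open neighbourhoods of `x`
(the complements of the finite sets `T ∌ x`), of the sections over the intersection with `W`. -/
def pushStalk {K : Type*} [Field K] {M : Type*} [AddCommGroup M] (W : Set (ClosedPoint K))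
    (S : ClosedPoint K → AddSubgroup M) (x : ClosedPoint K) : AddSubgroup M where
  carrier := {m | ∃ T : Set (ClosedPoint K), T.Finite ∧ x ∉ T ∧ ∀ y ∈ W, y ∉ T → m ∈ S y}
  zero_mem' := ⟨∅, Set.finite_empty, by simp, fun y _ _ => (S y).zero_mem⟩
  add_mem' := by
    rintro a b ⟨T, hT, hx, h⟩ ⟨T', hT', hx', h'⟩
    refine ⟨T ∪ T', hT.union hT', by simp [hx, hx'], fun y hy hyT => ?_⟩
    simp only [Set.mem_union, not_or] at hyT
    exact (S y).add_mem (h y hy hyT.1) (h' y hy hyT.2)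
  neg_mem' := by
    rintro a ⟨T, hT, hx, h⟩
    exact ⟨T, hT, hx, fun y hy hyT => (S y).neg_mem (h y hy hyT)⟩

/-- `A₀ → A₁` is a subcomplex of `B₀ → B₁` (all with differential `d`, in degrees 0 and 1), and the
inclusion is a quasi-isomorphism, that is, bijective on `H⁰ = ker` and on `H¹ = coker`
(injectivity on `H⁰` is automatic). -/
structure IsQuasiIsoInclusion {M N : Type*} [AddCommGroup M] [AddCommGroup N] (d : M →+ N)
    (A₀ B₀ : AddSubgroup M) (A₁ B₁ : AddSubgroup N) : Prop where
  le_zero : A₀ ≤ B₀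
  le_one : A₁ ≤ B₁
  map_sub : ∀ a ∈ A₀, d a ∈ A₁
  map_big : ∀ b ∈ B₀, d b ∈ B₁
  surj_H0 : ∀ b ∈ B₀, d b = 0 → b ∈ A₀
  inj_H1 : ∀ a ∈ A₁, (∃ b ∈ B₀, d b = a) → ∃ a₀ ∈ A₀, d a₀ = a
  surj_H1 : ∀ b ∈ B₁, ∃ a ∈ A₁, ∃ b₀ ∈ B₀, b = a + d b₀

/-- The map of complexes of sheaves on `ℙ¹_K`
`(L → L ⊗ ω(𝒟)) ⟶ (λ_* E_W → λ_* (E_W ⊗ ω))` (differentials `∇_{/K}`), where `W` is the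
complement of the support of `𝒟` and `λ` its embedding, is a quasi-isomorphism. This is tested on
the stalks at the closed points; at the generic point both complexes have the stalk
`V → Ω¹_{K(t)/K} ⊗ V`, with the identity as the map. -/
def IsDeRhamQuasiIso {k K : Type*} [Field k] [Field K] [Algebra k K]
    {V : Type*} [AddCommGroup V] [Module (RatFunc K) V]
    (L E : VecBundle K V) (N : Connection k K V) (𝒟 : EffDivisor K) : Prop :=
  ∀ x, IsQuasiIsoInclusion N.rel
    (L.stalk x).toAddSubgroup
    (pushStalk {y | 𝒟 y = 0} (fun y => (E.stalk y).toAddSubgroup) x)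
    (relForms L x (𝒟 x)).toAddSubgroup
    (pushStalk {y | 𝒟 y = 0} (fun y => (relForms E y 0).toAddSubgroup) x)

end

end P1Conn

namespace P1Conn

noncomputable section

/-! ### Valuations at the closed points -/

section Points

variable {K : Type*} [Field K]

/-! By Birkhoff and Grothendieck, `E` is a sum of line bundles `𝒪(dᵢ)`, with a frame `bᵢ` over the
affine line such that the `t^{dᵢ} bᵢ` form a frame at infinity. The new bundle `L` is generated at
every point by `hᵢ bᵢ` for rational functions `hᵢ`, so it is trivial by construction. What remains
is to choose the `hᵢ` so that `L` differs from `E` only in harmless ways (`exists_balancing`).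

Write `∇_{/K} v = dz ⊗ D v` in a local coordinate `z`, and put `P_n = z^m D - n z^(m-1)`. Then `z^m
D (z^(-n) e) = z^(-n) P_n e`, so `P_n` describes what `z^m D` does to the leading term of a pole of
order `n`. Everything local is expressed through injectivity of `P_n` on `S / z S` (`InjModAt`).

Two changes of the lattice are harmless. At a point `x₁` with `m ≥ 2` all `hᵢ` may be shifted by a
common order: this replaces `P_n` by `P_{n+c}`, and the two agree modulo `z`
(`IsAdmissibleAt.twist`). For `m = 1` the same twist would move the residue eigenvalues by integers;
this is why a point with `m ≥ 2` is needed. At a regular point the `hᵢ` may have poles of order one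
or two: in the frame `z^{aᵢ} bᵢ` with `aᵢ ∈ {-1, -2}` the matrix acquires the diagonal `aᵢ dz/z` and
the factors `z^(aⱼ - aᵢ)`, which is exactly the special pseudo-logarithmic shape
(`isSpecialPseudoLogAt_of_regular`). Taking more double poles where `dᵢ` is smaller equalises the
degrees, and the common excess is placed at `x₁`.

For the quasi-isomorphism, injectivity of `P_n` on the finite dimensional fibre gives surjectivity.
If it holds for all `n ≥ 1`, then `D : V/S → V/z^(-m) S` is bijective on each graded piece by pole
order, hence bijective. Since the stalk of `λ_*` at a singular point is the whole generic fibre, the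
quotient complex is acyclic (`isQuasiIsoInclusion_of_injModAt`). The criterion follows from the
polar part if `m ≥ 2`, from the residue condition at admissible points with `m = 1`, and at the
added points from a block triangular residue with eigenvalues `-1` and `-2`. -/

theorem mem_localRing {x : ClosedPoint K} {f : RatFunc K} : f ∈ localRing x ↔ val x f ≤ 1 := Iff.rfl

theorem val_algebraMap_le (v : IsDedekindDomain.HeightOneSpectrum K[X]) (p : K[X]) :
    val (some v) (algebraMap K[X] (RatFunc K) p) ≤ 1 := v.valuation_le_one p

theorem val_algebraMap_eq_one {v : IsDedekindDomain.HeightOneSpectrum K[X]} {p : K[X]} :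
    val (some v) (algebraMap K[X] (RatFunc K) p) = 1 ↔ p ∉ v.asIdeal :=
  v.valuation_eq_one_iff_notMem

theorem val_algebraMap_lt_one {v : IsDedekindDomain.HeightOneSpectrum K[X]} {p : K[X]} :
    val (some v) (algebraMap K[X] (RatFunc K) p) < 1 ↔ p ∈ v.asIdeal :=
  v.valuation_lt_one_iff_mem (K := RatFunc K) p

theorem val_none_algebraMap {p : K[X]} (hp : p ≠ 0) :
    val (none : ClosedPoint K) (algebraMap K[X] (RatFunc K) p) = exp (p.natDegree : ℤ) := by
  classical
  simp only [val]
  rw [RatFunc.inftyValuation_apply]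
  convert RatFunc.inftyValuation.polynomial K hp

theorem val_none_X : val (none : ClosedPoint K) RatFunc.X = exp 1 := by
  rw [← RatFunc.algebraMap_X, val_none_algebraMap X_ne_zero, natDegree_X]
  rfl

theorem val_C (x : ClosedPoint K) {c : K} (hc : c ≠ 0) : val x (RatFunc.C c) = 1 := by
  rw [← RatFunc.algebraMap_C]
  cases x with
  | none => rw [val_none_algebraMap (by simpa using hc)]; simp
  | some v =>
    rw [val_algebraMap_eq_one]
    intro h
    exact v.isPrime.ne_top (Ideal.eq_top_of_isUnit_mem _ h (by simpa using hc))

theorem val_C_le (x : ClosedPoint K) (c : K) : val x (RatFunc.C c) ≤ 1 := by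
  by_cases hc : c = 0
  · simp [hc]
  · exact (val_C x hc).le

theorem finite_val_not_le (f : RatFunc K) : {x : ClosedPoint K | ¬ val x f ≤ 1}.Finite := by
  have h := IsDedekindDomain.HeightOneSpectrum.Support.finite K[X] f
  refine ((h.image some).union (Set.finite_singleton none)).subset ?_
  rintro (_ | v) hv
  · simp
  · left
    exact ⟨v, by simpa [val, IsDedekindDomain.HeightOneSpectrum.Support] using hv, rfl⟩

theorem exists_polynomial_of_val_le_one {f : RatFunc K}
    (h : ∀ v : IsDedekindDomain.HeightOneSpectrum K[X], val (some v) f ≤ 1) :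
    ∃ p : K[X], algebraMap K[X] (RatFunc K) p = f :=
  IsDedekindDomain.HeightOneSpectrum.mem_integers_of_valuation_le_one (RatFunc K) f h

theorem le_exp_sub_one_iff {a : ℤᵐ⁰} {n : ℤ} : a ≤ exp (n - 1) ↔ a < exp n := by
  rcases eq_or_ne a 0 with rfl | h
  · simp
  · rw [← log_le_iff_le_exp h, ← log_lt_iff_lt_exp h]
    omega

theorem le_exp_neg_one_iff {a : ℤᵐ⁰} : a ≤ exp (-1 : ℤ) ↔ a < 1 := by
  simpa using le_exp_sub_one_iff (a := a) (n := 0)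

theorem exists_nat_le_exp (a : ℤᵐ⁰) : ∃ n : ℕ, a ≤ exp (n : ℤ) := by
  rcases eq_or_ne a 0 with rfl | h
  · exact ⟨0, by simp⟩
  · exact ⟨(log a).toNat, (log_le_iff_le_exp h).1 (Int.self_le_toNat _)⟩

theorem IsParam.ne_zero {x : ClosedPoint K} {z : RatFunc K} (hz : IsParam x z) : z ≠ 0 := by
  rintro rfl
  exact exp_ne_zero (hz.symm.trans (map_zero _))

theorem IsParam.val_zpow {x : ClosedPoint K} {z : RatFunc K} (hz : IsParam x z) (n : ℤ) :
    val x (z ^ n) = exp (-n) := by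
  rw [map_zpow₀, hz, ← exp_zsmul]; simp

theorem IsParam.val_lt_one {x : ClosedPoint K} {z : RatFunc K} (hz : IsParam x z) :
    val x z < 1 := le_exp_neg_one_iff.1 hz.le

theorem IsParam.val_zpow_mul_le {x : ClosedPoint K} {z : RatFunc K} (hz : IsParam x z) (n m : ℤ)
    (f : RatFunc K) : val x (z ^ n * f) ≤ exp m ↔ val x f ≤ exp (m + n) := by
  rw [map_mul, hz.val_zpow, exp_add, exp_neg, inv_mul_le_iff₀ (by simp [zero_lt_iff]), mul_comm]

/-- `z` is a local parameter at `x` such that the regular functions at `x` are the quotients of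
polynomials in `z` that are defined at `z = 0`. -/
structure IsCoord (x : ClosedPoint K) (z : RatFunc K) : Prop where
  isParam : IsParam x z
  exists_eq : ∀ f ∈ localRing x, ∃ P Q : K[X], Q.coeff 0 ≠ 0 ∧ f = aeval z P / aeval z Q

theorem IsParam.val_aeval_sub_lt {x : ClosedPoint K} {z : RatFunc K} (hz : IsParam x z) (P : K[X]) :
    val x (aeval z P - RatFunc.C (P.coeff 0)) < 1 := by
  have hle : ∀ P : K[X], val x (aeval z P) ≤ 1 := by
    intro P
    induction P using Polynomial.induction_on' with
    | add p q hp hq => rw [map_add]; exact Valuation.map_add_le _ hp hq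
    | monomial n a =>
      rw [aeval_monomial, map_mul, map_pow]
      exact mul_le_one' (val_C_le x a) (pow_le_one' hz.val_lt_one.le n)
  have : aeval z P - RatFunc.C (P.coeff 0) = z * aeval z P.divX := by
    have h := congrArg (aeval z) P.divX_mul_X_add
    rw [map_add, map_mul, aeval_X, aeval_C, ← RatFunc.algebraMap_eq_C] at *
    rw [← h]
    ring
  rw [this, map_mul]
  exact mul_lt_one_of_lt_of_le hz.val_lt_one (hle _)

theorem IsParam.val_aeval_le {x : ClosedPoint K} {z : RatFunc K} (hz : IsParam x z) (P : K[X]) :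
    val x (aeval z P) ≤ 1 := by
  have := Valuation.map_add_le _ (hz.val_aeval_sub_lt P).le (val_C_le x (P.coeff 0))
  simpa using this

theorem IsParam.val_aeval_eq_one {x : ClosedPoint K} {z : RatFunc K} (hz : IsParam x z) {Q : K[X]}
    (hQ : Q.coeff 0 ≠ 0) : val x (aeval z Q) = 1 := by
  have h1 := hz.val_aeval_sub_lt Q
  have h2 := val_C x hQ
  have := Valuation.map_add_eq_of_lt_left (val x) (h1.trans_eq h2.symm)
  simpa [h2] using this

theorem IsCoord.isRational {x : ClosedPoint K} {z : RatFunc K} (hz : IsCoord x z) :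
    IsRational x := by
  intro f hf
  obtain ⟨P, Q, hQ, rfl⟩ := hz.exists_eq f hf
  refine ⟨P.coeff 0 / Q.coeff 0, ?_⟩
  have hQ1 := hz.isParam.val_aeval_eq_one hQ
  have hQ0 : aeval z Q ≠ 0 := by
    intro h
    simp [h] at hQ1
  have := hz.isParam.val_aeval_sub_lt (P - Polynomial.C (P.coeff 0 / Q.coeff 0) * Q)
  have h0 : (P - Polynomial.C (P.coeff 0 / Q.coeff 0) * Q).coeff 0 = 0 := by
    simp [hQ]
  rw [h0, map_zero, sub_zero] at this
  have e : aeval z P / aeval z Q - RatFunc.C (P.coeff 0 / Q.coeff 0) =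
      aeval z (P - Polynomial.C (P.coeff 0 / Q.coeff 0) * Q) / aeval z Q := by
    rw [map_sub, map_mul, aeval_C, sub_div, mul_div_cancel_right₀ _ hQ0]
    rfl
  rwa [e, map_div₀, hQ1, div_one]

/-- The closed point `t = a`. -/
def pt (a : K) : IsDedekindDomain.HeightOneSpectrum K[X] where
  asIdeal := Ideal.span {X - Polynomial.C a}
  isPrime := by
    rw [Ideal.span_singleton_prime (X_sub_C_ne_zero a)]
    exact prime_X_sub_C a
  ne_bot := by simpa using X_sub_C_ne_zero a

theorem mem_pt {a : K} {p : K[X]} : p ∈ (pt a).asIdeal ↔ p.eval a = 0 := by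
  rw [pt, Ideal.mem_span_singleton, dvd_iff_isRoot, IsRoot.def]

theorem pt_injective : Function.Injective (pt : K → _) := by
  intro a b h
  have : (X - Polynomial.C a) ∈ (pt b).asIdeal := by
    rw [← h, mem_pt]; simp
  rw [mem_pt] at this
  simpa [sub_eq_zero, eq_comm] using this

theorem eq_pt_of_mem {a : K} {v : IsDedekindDomain.HeightOneSpectrum K[X]}
    (h : X - Polynomial.C a ∈ v.asIdeal) : v = pt a := by
  have hmax : (Ideal.span {X - Polynomial.C a}).IsMaximal :=
    PrincipalIdealRing.isMaximal_of_irreducible (irreducible_X_sub_C a)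
  apply IsDedekindDomain.HeightOneSpectrum.ext
  refine (hmax.eq_of_le v.isPrime.ne_top ?_).symm
  rw [Ideal.span_singleton_le_iff_mem]
  exact h

theorem isParam_pt (a : K) :
    IsParam (some (pt a)) (algebraMap K[X] (RatFunc K) (X - Polynomial.C a)) := by
  have := (pt a).intValuation_singleton (X_sub_C_ne_zero a) rfl
  exact ((pt a).valuation_of_algebraMap _).trans this

theorem isCoord_pt (a : K) :
    IsCoord (some (pt a)) (algebraMap K[X] (RatFunc K) (X - Polynomial.C a)) := by
  refine ⟨isParam_pt a, fun f hf => ?_⟩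
  obtain ⟨p, s, h⟩ := (pt a).exists_primeCompl_mul_eq_of_integer (K := RatFunc K) f hf
  have hs : s.1.eval a ≠ 0 := fun h0 => s.2 (mem_pt.2 h0)
  -- Taylor expansion at `a` rewrites a polynomial in `t` as a polynomial in `t - a`.
  have key : ∀ p : K[X], aeval (algebraMap K[X] (RatFunc K) (X - Polynomial.C a)) (taylor a p) =
      algebraMap K[X] (RatFunc K) p := by
    intro p
    rw [taylor_apply, aeval_comp, aeval_algebraMap_apply]
    simp
  refine ⟨taylor a p, taylor a s.1, by simpa [taylor_coeff_zero] using hs, ?_⟩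
  rw [key, key, eq_div_iff, ← h]
  intro h0
  have : s.1 = 0 := by simpa using h0
  exact hs (by simp [this])

/-- Reversing numerator and denominator at the degree of the denominator gives polynomials in `1/t`.
Regularity at infinity is the degree inequality that makes this possible, and the leading
coefficient of the denominator becomes the nonzero constant term. -/
theorem isCoord_infty : IsCoord (none : ClosedPoint K) (RatFunc.X⁻¹) := by
  have hpar : IsParam (none : ClosedPoint K) (RatFunc.X⁻¹) := by
    rw [IsParam, map_inv₀, val_none_X, exp_neg]
  refine ⟨hpar, fun f hf => ?_⟩
  obtain ⟨p, q, hq, rfl⟩ := IsFractionRing.div_surjective (A := K[X]) f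
  have hq0 : q ≠ 0 := nonZeroDivisors.ne_zero hq
  have key : ∀ p : K[X], p.natDegree ≤ q.natDegree →
      aeval (RatFunc.X⁻¹) (p.reflect q.natDegree) * RatFunc.X ^ q.natDegree =
        algebraMap K[X] (RatFunc K) p := by
    intro p hp
    let : Invertible (RatFunc.X : RatFunc K) := invertibleOfNonzero RatFunc.X_ne_zero
    have := eval₂_reflect_mul_pow (algebraMap K (RatFunc K)) RatFunc.X q.natDegree p hp
    rw [invOf_eq_inv, ← aeval_def, ← aeval_def] at this
    rw [this, ← RatFunc.algebraMap_X, aeval_algebraMap_apply, aeval_X_left_apply]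
  refine ⟨p.reflect q.natDegree, q.reflect q.natDegree, by simpa [coeff_reflect] using hq0, ?_⟩
  have hp : p.natDegree ≤ q.natDegree := by
    by_cases hp0 : p = 0
    · simp [hp0]
    rw [mem_localRing, map_div₀, val_none_algebraMap hp0, val_none_algebraMap hq0, ← exp_sub,
      ← exp_zero, exp_le_exp] at hf
    omega
  rw [← key p hp, ← key q le_rfl, mul_div_mul_right]
  exact pow_ne_zero _ RatFunc.X_ne_zero

theorem IsRational.eq_pt {v : IsDedekindDomain.HeightOneSpectrum K[X]}
    (h : IsRational (some v : ClosedPoint K)) : ∃ a, v = pt a := by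
  obtain ⟨a, ha⟩ := h (algebraMap K[X] (RatFunc K) X) (val_algebraMap_le v X)
  refine ⟨a, eq_pt_of_mem ?_⟩
  rw [← val_algebraMap_lt_one]
  simpa using ha

theorem IsRational.exists_isCoord {x : ClosedPoint K} (h : IsRational x) : ∃ z, IsCoord x z := by
  cases x with
  | none => exact ⟨_, isCoord_infty⟩
  | some v =>
    obtain ⟨a, rfl⟩ := h.eq_pt
    exact ⟨_, isCoord_pt a⟩

theorem val_sub_C_eq_one {a : K} {v : IsDedekindDomain.HeightOneSpectrum K[X]} (h : v ≠ pt a) :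
    val (some v) (algebraMap K[X] (RatFunc K) (X - Polynomial.C a)) = 1 :=
  val_algebraMap_eq_one.2 fun h' => h (eq_pt_of_mem h')

/-- The reduction map `𝒪_x → K` at a rational point. -/
def residue {x : ClosedPoint K} (hx : IsRational x) : localRing x →+* K :=
  -- Nonzero constants have valuation one, so a value in `K` is unique; this makes the chosen values
  -- additive and multiplicative.
  have huniq : ∀ {f : RatFunc K} {c d : K}, val x (f - RatFunc.C c) < 1 →
      val x (f - RatFunc.C d) < 1 → c = d := by
    intro f c d hc hd
    by_contra hne
    have := Valuation.map_sub_lt _ hd hc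
    rw [sub_sub_sub_cancel_left, ← map_sub, val_C x (sub_ne_zero.2 hne)] at this
    exact lt_irrefl _ this
  have hspec : ∀ f : localRing x, val x (f.1 - RatFunc.C (hx f.1 f.2).choose) < 1 :=
    fun f => (hx f.1 f.2).choose_spec
  { toFun := fun f => (hx f.1 f.2).choose
    map_one' := huniq (hspec 1) (by simp)
    map_zero' := huniq (hspec 0) (by simp)
    map_add' := fun f g => huniq (hspec (f + g)) (by
      have := Valuation.map_add_lt _ (hspec f) (hspec g)
      rw [map_add]
      convert this using 2
      push_cast
      ring)
    map_mul' := fun f g => huniq (hspec (f * g)) (by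
      rw [map_mul]
      have e : ((f * g : localRing x) : RatFunc K) -
          RatFunc.C (hx f.1 f.2).choose * RatFunc.C (hx g.1 g.2).choose =
          f.1 * (g.1 - RatFunc.C (hx g.1 g.2).choose) +
          RatFunc.C (hx g.1 g.2).choose * (f.1 - RatFunc.C (hx f.1 f.2).choose) := by
        push_cast
        ring
      rw [e]
      apply Valuation.map_add_lt
      · rw [map_mul]
        exact (mul_le_of_le_one_left' f.2).trans_lt (hspec g)
      · rw [map_mul]
        exact (mul_le_of_le_one_left' (val_C_le x _)).trans_lt (hspec f)) }

theorem val_sub_residue {x : ClosedPoint K} (hx : IsRational x) (f : localRing x) :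
    val x (f.1 - RatFunc.C (residue hx f)) < 1 :=
  (hx f.1 f.2).choose_spec

theorem residue_eq_zero_iff {x : ClosedPoint K} (hx : IsRational x) (f : localRing x) :
    residue hx f = 0 ↔ val x f.1 < 1 := by
  have h := val_sub_residue hx f
  constructor
  · intro h0
    simpa [h0] using h
  · intro h1
    by_contra h0
    have := Valuation.map_sub_lt _ h1 h
    rw [sub_sub_cancel, val_C x h0] at this
    exact lt_irrefl _ this

theorem isUnit_iff_residue_ne_zero {x : ClosedPoint K} (hx : IsRational x) (f : localRing x) :
    IsUnit f ↔ residue hx f ≠ 0 := by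
  refine ⟨fun h => (h.map (residue hx)).ne_zero, fun h => ?_⟩
  have h1 : val x f.1 = 1 := by
    refine le_antisymm f.2 (not_lt.1 fun h' => h ((residue_eq_zero_iff hx f).2 h'))
  have hf0 : f.1 ≠ 0 := fun h0 => by simp [h0] at h1
  refine IsUnit.of_mul_eq_one ⟨f.1⁻¹, ?_⟩ (Subtype.ext (mul_inv_cancel₀ hf0))
  rw [mem_localRing, map_inv₀, h1, inv_one]

theorem residue_C {x : ClosedPoint K} (hx : IsRational x) (c : K) :
    residue hx ⟨RatFunc.C c, val_C_le x c⟩ = c := by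
  by_contra h
  have := val_sub_residue hx ⟨RatFunc.C c, val_C_le x c⟩
  rw [← map_sub, val_C x (sub_ne_zero.2 (Ne.symm h))] at this
  exact lt_irrefl _ this

/-- A matrix over `𝒪_x` that is not invertible kills a constant vector modulo `𝔪_x`. -/
theorem exists_const_of_not_isUnit_det {x : ClosedPoint K} (hx : IsRational x)
    {ι : Type*} [Fintype ι] [DecidableEq ι] {g : Matrix ι ι (localRing x)} (hg : ¬ IsUnit g.det) :
    ∃ u : ι → K, u ≠ 0 ∧ ∀ i, val x (∑ j, (g i j : RatFunc K) * RatFunc.C (u j)) < 1 := by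
  rw [isUnit_iff_residue_ne_zero hx, not_not, RingHom.map_det] at hg
  obtain ⟨u, hu, h⟩ := Matrix.exists_mulVec_eq_zero_iff.2 hg
  refine ⟨u, hu, fun i => ?_⟩
  have h1 := congrFun h i
  have := (residue_eq_zero_iff hx (∑ j, g i j * ⟨RatFunc.C (u j), val_C_le x (u j)⟩)).1 (by
    rw [map_sum]
    simp_rw [map_mul, residue_C]
    simpa [Matrix.mulVec, dotProduct] using h1)
  simpa using this

/-- Localisation is formally étale, so the differentials of `K(t)` are the base change of those of
`K[t]`, which are free on `dt`. -/
theorem dX_ne_zero : KaehlerDifferential.D K (RatFunc K) RatFunc.X ≠ 0 := by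
  have : Algebra.FormallyEtale K[X] (RatFunc K) :=
    Algebra.FormallyEtale.of_isLocalization (nonZeroDivisors K[X])
  intro h
  have h1 : KaehlerDifferential.tensorKaehlerEquivOfFormallyEtale K K[X] (RatFunc K)
      (1 ⊗ₜ KaehlerDifferential.D K K[X] X) = 0 := by
    simpa using h
  rw [LinearEquiv.map_eq_zero_iff] at h1
  have h2 := congrArg (LinearMap.lTensor (RatFunc K)
    (KaehlerDifferential.polynomialEquiv K).toLinearMap) h1
  have h3 := congrArg (TensorProduct.rid K[X] (RatFunc K)) h2
  simp at h3

end Points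

/-! ### Lattices -/

section Lattices

variable {K : Type*} [Field K] {x : ClosedPoint K}
  {M : Type*} [AddCommGroup M] [Module (RatFunc K) M]
  {V : Type*} [AddCommGroup V] [Module (RatFunc K) V] {ι : Type*}

theorem smul_mem_of_val_le {S : Submodule (localRing x) V} {f : RatFunc K} (hf : val x f ≤ 1) {v : V}
    (hv : v ∈ S) : f • v ∈ S :=
  S.smul_mem (⟨f, hf⟩ : localRing x) hv

theorem IsParam.zpow_smul_mem {z : RatFunc K} (hz : IsParam x z) {S : Submodule (localRing x) V}
    {a b : ℤ} (hab : a ≤ b) {v : V} (hv : z ^ a • v ∈ S) : z ^ b • v ∈ S := by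
  have e : z ^ b • v = z ^ (b - a) • z ^ a • v := by
    rw [smul_smul, ← zpow_add₀ hz.ne_zero, sub_add_cancel]
  rw [e]
  refine smul_mem_of_val_le ?_ hv
  rw [hz.val_zpow, ← exp_zero, exp_le_exp]
  omega

theorem mem_span_basis_iff [Finite ι] (b : Module.Basis ι (RatFunc K) V) {v : V} :
    v ∈ Submodule.span (localRing x) (Set.range b) ↔ ∀ i, val x (b.repr v i) ≤ 1 := by
  classical
  have := Fintype.ofFinite ι
  constructor
  · intro h i
    induction h using Submodule.span_induction with
    | mem v hv =>
      obtain ⟨j, rfl⟩ := hv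
      rw [b.repr_self, Finsupp.single_apply]
      split_ifs <;> simp
    | zero => simp
    | add u v _ _ hu hv => rw [map_add, Finsupp.add_apply]; exact Valuation.map_add_le _ hu hv
    | smul c u _ hu =>
      rw [Subring.smul_def, map_smul, Finsupp.smul_apply, smul_eq_mul, map_mul]
      exact mul_le_one' c.2 hu
  · intro h
    rw [← b.sum_repr v]
    exact Submodule.sum_mem _ fun i _ => smul_mem_of_val_le (h i) (Submodule.subset_span ⟨i, rfl⟩)

/-- The basis `hᵢ bᵢ`. -/
def scale (b : Module.Basis ι (RatFunc K) V) (h : ι → RatFunc K) (hh : ∀ i, h i ≠ 0) :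
    Module.Basis ι (RatFunc K) V :=
  b.isUnitSMul fun i => (hh i).isUnit

@[simp] theorem scale_apply (b : Module.Basis ι (RatFunc K) V) (h : ι → RatFunc K)
    (hh : ∀ i, h i ≠ 0) (i : ι) : scale b h hh i = h i • b i := by
  simp [scale, Module.Basis.isUnitSMul_apply]

theorem scale_repr [Finite ι] (b : Module.Basis ι (RatFunc K) V) (h : ι → RatFunc K)
    (hh : ∀ i, h i ≠ 0) (v : V) (i : ι) : (scale b h hh).repr v i = (h i)⁻¹ * b.repr v i := by
  have := Fintype.ofFinite ι
  have e : v = ∑ j, ((h j)⁻¹ * b.repr v j) • scale b h hh j := by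
    conv_lhs => rw [← b.sum_repr v]
    refine Finset.sum_congr rfl fun j _ => ?_
    rw [scale_apply, smul_smul]
    congr 1
    field_simp [hh j]
  conv_lhs => rw [e]
  rw [Module.Basis.repr_sum_self]

/-- Lattices with frames proportional to one fixed basis are compared through valuations alone; `E`
and `L` are compared in this way. -/
theorem mem_span_scale_iff [Finite ι] (b : Module.Basis ι (RatFunc K) V) (h : ι → RatFunc K)
    (hh : ∀ i, h i ≠ 0) {v : V} :
    v ∈ Submodule.span (localRing x) (Set.range (scale b h hh)) ↔
      ∀ i, val x (b.repr v i) ≤ val x (h i) := by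
  rw [mem_span_basis_iff]
  refine forall_congr' fun i => ?_
  rw [scale_repr, map_mul, map_inv₀, inv_mul_le_iff₀, mul_one]
  exact zero_lt_iff.2 ((Valuation.ne_zero_iff _).2 (hh i))

theorem mem_twist_iff {z : RatFunc K} (hz : IsParam x z) (n : ℤ) {S : Submodule (localRing x) M}
    {w : M} : w ∈ twist x n S ↔ z ^ n • w ∈ S := by
  constructor
  · intro h
    induction h using Submodule.span_induction with
    | mem w hw =>
      obtain ⟨g, hg, s, hs, rfl⟩ := hw
      rw [smul_smul]
      refine smul_mem_of_val_le ?_ hs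
      rw [← exp_zero, hz.val_zpow_mul_le]
      simpa using hg
    | zero => simp
    | add u v _ _ hu hv => rw [smul_add]; exact S.add_mem hu hv
    | smul c u _ hu =>
      rw [Subring.smul_def, smul_comm]
      exact smul_mem_of_val_le c.2 hu
  · intro h
    refine Submodule.subset_span ⟨z ^ (-n), ?_, _, h, ?_⟩
    · rw [hz.val_zpow, neg_neg]
    · rw [smul_smul, ← zpow_add₀ hz.ne_zero]
      simp

/-- A pole condition on `∇` thus becomes a condition on the entries of its matrix. -/
theorem mem_tens_span_iff [Fintype ι] {S : Submodule (localRing x) M}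
    (b : ι → V) {ξ : M ⊗[RatFunc K] V} :
    ξ ∈ tens x S (Submodule.span (localRing x) (Set.range b)) ↔
      ∃ s : ι → M, (∀ i, s i ∈ S) ∧ ξ = ∑ i, s i ⊗ₜ[RatFunc K] b i := by
  classical
  constructor
  · intro h
    induction h using Submodule.span_induction with
    | mem w hw =>
      obtain ⟨s, hs, e, he, rfl⟩ := hw
      obtain ⟨c, rfl⟩ := (Submodule.mem_span_range_iff_exists_fun _).1 he
      refine ⟨fun i => c i • s, fun i => S.smul_mem _ hs, ?_⟩
      rw [TensorProduct.tmul_sum]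
      refine Finset.sum_congr rfl fun i _ => ?_
      exact (TensorProduct.smul_tmul (c i).1 s (b i)).symm
    | zero => exact ⟨0, by simp, by simp⟩
    | add u v _ _ hu hv =>
      obtain ⟨s, hs, rfl⟩ := hu
      obtain ⟨t, ht, rfl⟩ := hv
      exact ⟨s + t, fun i => S.add_mem (hs i) (ht i), by
        simp [TensorProduct.add_tmul, Finset.sum_add_distrib]⟩
    | smul c u _ hu =>
      obtain ⟨s, hs, rfl⟩ := hu
      refine ⟨c • s, fun i => S.smul_mem _ (hs i), ?_⟩
      rw [Finset.smul_sum]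
      rfl
  · rintro ⟨s, hs, rfl⟩
    exact Submodule.sum_mem _ fun i _ =>
      Submodule.subset_span ⟨s i, hs i, b i, Submodule.subset_span ⟨i, rfl⟩, rfl⟩

theorem smul_mem_tens {S : Submodule (localRing x) M} {T T' : Submodule (localRing x) V}
    {f : RatFunc K} (hf : ∀ e ∈ T, f • e ∈ T') {ξ : M ⊗[RatFunc K] V} (hξ : ξ ∈ tens x S T) :
    f • ξ ∈ tens x S T' := by
  induction hξ using Submodule.span_induction with
  | mem w hw =>
    obtain ⟨s, hs, e, he, rfl⟩ := hw
    exact Submodule.subset_span ⟨s, hs, f • e, hf e he, (TensorProduct.tmul_smul f s e).symm⟩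
  | zero => simp
  | add u v _ _ hu hv => rw [smul_add]; exact Submodule.add_mem _ hu hv
  | smul c u _ hu =>
    have e : f • c • u = c • f • u := smul_comm f c.1 u
    rw [e]
    exact Submodule.smul_mem _ c hu

end Lattices

/-! ### Differential forms at a rational point -/

section Forms

variable {k K : Type*} [Field k] [Field K] [Algebra k K] {x : ClosedPoint K} {z : RatFunc K}

theorem D_mem_regForms {f : RatFunc K} (hf : val x f ≤ 1) :
    KaehlerDifferential.D k (RatFunc K) f ∈ regForms x k :=
  Submodule.subset_span ⟨f, hf, rfl⟩

theorem D_C_mem_constForms (c : K) :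
    KaehlerDifferential.D k (RatFunc K) (RatFunc.C c) ∈ constForms x k :=
  Submodule.subset_span ⟨c, rfl⟩

/-- The quotient rule reduces to polynomials in `z`, whose differentials involve only `dz` and the
differentials of their coefficients in `K`. -/
theorem IsCoord.regForms_le (hz : IsCoord x z) :
    regForms x k ≤ Submodule.span (localRing x) {KaehlerDifferential.D k (RatFunc K) z} ⊔
      constForms x k := by
  set T := Submodule.span (localRing x) {KaehlerDifferential.D k (RatFunc K) z} ⊔ constForms x k
  have hdz : KaehlerDifferential.D k (RatFunc K) z ∈ T :=
    Submodule.mem_sup_left (Submodule.mem_span_singleton_self _)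
  have hC : ∀ c : K, KaehlerDifferential.D k (RatFunc K) (RatFunc.C c) ∈ T := fun c =>
    Submodule.mem_sup_right (D_C_mem_constForms c)
  have hpoly : ∀ P : K[X], KaehlerDifferential.D k (RatFunc K) (aeval z P) ∈ T := by
    intro P
    induction P using Polynomial.induction_on' with
    | add p q hp hq => rw [map_add, map_add]; exact T.add_mem hp hq
    | monomial n a =>
      rw [aeval_monomial, RatFunc.algebraMap_eq_C, Derivation.leibniz, Derivation.leibniz_pow,
        ← Nat.cast_smul_eq_nsmul (RatFunc K)]
      have hzn : ∀ n : ℕ, val x (z ^ n) ≤ 1 := fun n => by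
        rw [map_pow]; exact pow_le_one' hz.isParam.val_lt_one.le n
      refine T.add_mem (smul_mem_of_val_le (val_C_le x a) (smul_mem_of_val_le ?_
        (smul_mem_of_val_le (hzn _) hdz))) (smul_mem_of_val_le (hzn n) (hC a))
      have := val_C_le x (n : K)
      simpa using this
  refine Submodule.span_le.2 ?_
  rintro _ ⟨f, hf, rfl⟩
  obtain ⟨P, Q, hQ, rfl⟩ := hz.exists_eq f hf
  have hQ1 := hz.isParam.val_aeval_eq_one hQ
  rw [Derivation.leibniz_div]
  refine smul_mem_of_val_le (by simp [hQ1]) (T.sub_mem ?_ ?_)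
  · exact smul_mem_of_val_le hQ1.le (hpoly P)
  · exact smul_mem_of_val_le (hz.isParam.val_aeval_le P) (hpoly Q)

theorem IsCoord.exists_of_mem_regForms (hz : IsCoord x z) {w : Ω[RatFunc K⁄k]}
    (hw : w ∈ regForms x k) : ∃ f, val x f ≤ 1 ∧ ∃ η ∈ constForms x k,
      w = f • KaehlerDifferential.D k (RatFunc K) z + η := by
  obtain ⟨w₁, h₁, η, hη, rfl⟩ := Submodule.mem_sup.1 (hz.regForms_le hw)
  obtain ⟨f, rfl⟩ := Submodule.mem_span_singleton.1 h₁
  exact ⟨f.1, f.2, η, hη, rfl⟩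

/-- The shape of these forms does not depend on the parameter, so the single coordinate `z`
suffices. -/
theorem IsCoord.exists_of_mem_curlyForms (hz : IsCoord x z) {m : ℕ} (hm : m ≠ 0)
    {w : Ω[RatFunc K⁄k]} (hw : w ∈ curlyForms x k m) :
    ∃ f, val x f ≤ 1 ∧ ∃ η ∈ constForms x k,
      w = (f / z ^ m) • KaehlerDifferential.D k (RatFunc K) z + (z ^ (m - 1))⁻¹ • η := by
  rw [curlyForms, if_neg hm] at hw
  induction hw using Submodule.span_induction with
  | mem w hw =>
    obtain ⟨y, hy, f, hf, η, hη, rfl⟩ := hw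
    have hz0 := hz.isParam.ne_zero
    have hy0 := hy.ne_zero
    obtain ⟨u, rfl⟩ : ∃ u, y = u * z := ⟨y / z, by field_simp⟩
    have hu0 : u ≠ 0 := left_ne_zero_of_mul hy0
    have hu1 : val x u = 1 := by
      have h1 := hy
      rw [IsParam, map_mul, hz.isParam] at h1
      exact mul_right_cancel₀ exp_ne_zero (h1.trans (one_mul _).symm)
    obtain ⟨a, ha, θ, hθ, hdu⟩ := hz.exists_of_mem_regForms (D_mem_regForms (k := k) hu1.le)
    obtain ⟨n, rfl⟩ := Nat.exists_eq_succ_of_ne_zero hm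
    -- With `du = a dz + θ` one has `d(uz) = (u + z a) dz + z θ`. The extra factor `z` lowers the
    -- pole of the `θ` term by one, so this term joins `η`.
    refine ⟨f * (u ^ (n + 1))⁻¹ * (u + z * a), ?_,
      (f * (u ^ (n + 1))⁻¹) • θ + (u ^ n)⁻¹ • η, ?_, ?_⟩
    · rw [map_mul, map_mul]
      refine mul_le_one' (mul_le_one' hf (by simp [hu1])) (Valuation.map_add_le _ hu1.le ?_)
      rw [map_mul]
      exact mul_le_one' hz.isParam.val_lt_one.le ha
    · refine Submodule.add_mem _ (smul_mem_of_val_le ?_ hθ) (smul_mem_of_val_le (by simp [hu1]) hη)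
      rw [map_mul]
      exact mul_le_one' hf (by simp [hu1])
    · rw [Derivation.leibniz, hdu]
      simp only [Nat.succ_eq_add_one, Nat.add_sub_cancel, smul_add, smul_smul, mul_add]
      rw [add_div, add_smul]
      have e1 : f / (u * z) ^ (n + 1) * u = f * (u ^ (n + 1))⁻¹ * u / z ^ (n + 1) := by
        rw [mul_pow]
        field_simp
      have e2 : f / (u * z) ^ (n + 1) * (z * a) = f * (u ^ (n + 1))⁻¹ * (z * a) / z ^ (n + 1) := by
        rw [mul_pow]
        field_simp
      have e3 : f / (u * z) ^ (n + 1) * z = (z ^ n)⁻¹ * (f * (u ^ (n + 1))⁻¹) := by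
        rw [mul_pow]
        field_simp
        ring
      have e4 : ((u * z) ^ n)⁻¹ = (z ^ n)⁻¹ * (u ^ n)⁻¹ := by
        rw [mul_pow, mul_inv, mul_comm]
      rw [e1, e2, e3, e4]
      abel
  | zero => exact ⟨0, by simp, 0, Submodule.zero_mem _, by simp⟩
  | add u v _ _ hu hv =>
    obtain ⟨f, hf, η, hη, rfl⟩ := hu
    obtain ⟨g, hg, θ, hθ, rfl⟩ := hv
    exact ⟨f + g, Valuation.map_add_le _ hf hg, η + θ, Submodule.add_mem _ hη hθ, by
      rw [add_div, add_smul, smul_add]; abel⟩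
  | smul c u _ hu =>
    obtain ⟨f, hf, η, hη, rfl⟩ := hu
    refine ⟨c * f, by rw [map_mul]; exact mul_le_one' c.2 hf, c • η, Submodule.smul_mem _ _ hη, ?_⟩
    change c.1 • _ = _ + _ • c.1 • η
    rw [smul_add, smul_smul, smul_comm c.1, mul_div_assoc]

theorem IsParam.mem_curlyForms (hz : IsParam x z) {m : ℕ} (hm : m ≠ 0) {f : RatFunc K}
    (hf : val x f ≤ 1) {η : Ω[RatFunc K⁄k]} (hη : η ∈ constForms x k) :
    (f / z ^ m) • KaehlerDifferential.D k (RatFunc K) z + (z ^ (m - 1))⁻¹ • η ∈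
      curlyForms x k m := by
  rw [curlyForms, if_neg hm]
  exact Submodule.subset_span ⟨z, hz, f, hf, η, hη, rfl⟩

theorem D_C_eq_zero (c : K) : KaehlerDifferential.D K (RatFunc K) (RatFunc.C c) = 0 := by
  rw [← RatFunc.algebraMap_eq_C, Derivation.map_algebraMap]

theorem constForms_self : constForms x K = ⊥ := by
  rw [constForms, Submodule.span_eq_bot]
  rintro _ ⟨c, rfl⟩
  exact D_C_eq_zero c

theorem IsCoord.exists_of_mem_regForms_self (hz : IsCoord x z) {w : Ω[RatFunc K⁄K]}
    (hw : w ∈ regForms x K) : ∃ f, val x f ≤ 1 ∧ w = f • KaehlerDifferential.D K (RatFunc K) z := by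
  obtain ⟨f, hf, η, hη, rfl⟩ := hz.exists_of_mem_regForms hw
  rw [constForms_self, Submodule.mem_bot] at hη
  exact ⟨f, hf, by rw [hη, add_zero]⟩

/-- For each `f`, either `f` or `f⁻¹` is regular at `x`, so the local description of the regular
forms suffices. -/
theorem IsCoord.span_D (hz : IsCoord x z) (w : Ω[RatFunc K⁄K]) :
    w ∈ Submodule.span (RatFunc K) {KaehlerDifferential.D K (RatFunc K) z} := by
  have h : w ∈ Submodule.span (RatFunc K) (Set.range (KaehlerDifferential.D K (RatFunc K))) := by
    rw [KaehlerDifferential.span_range_derivation]; trivial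
  refine Submodule.span_le.2 ?_ h
  have key : ∀ f, val x f ≤ 1 → KaehlerDifferential.D K (RatFunc K) f ∈
      Submodule.span (RatFunc K) {KaehlerDifferential.D K (RatFunc K) z} := by
    intro f hf
    obtain ⟨g, -, hg⟩ := hz.exists_of_mem_regForms_self (D_mem_regForms (k := K) hf)
    exact Submodule.mem_span_singleton.2 ⟨g, hg.symm⟩
  rintro _ ⟨f, rfl⟩
  by_cases hf : val x f ≤ 1
  · exact key f hf
  · have : KaehlerDifferential.D K (RatFunc K) f⁻¹ ∈
      Submodule.span (RatFunc K) {KaehlerDifferential.D K (RatFunc K) z} := by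
      apply key
      rw [map_inv₀]
      exact inv_le_one_of_one_le₀ (not_le.1 hf).le
    rw [← inv_inv f, Derivation.leibniz_inv]
    exact Submodule.smul_mem _ _ this

theorem IsCoord.D_ne_zero (hz : IsCoord x z) : KaehlerDifferential.D K (RatFunc K) z ≠ 0 := by
  intro h
  have := hz.span_D (KaehlerDifferential.D K (RatFunc K) RatFunc.X)
  rw [h, Submodule.span_zero_singleton, Submodule.mem_bot] at this
  exact dX_ne_zero this

/-- The isomorphism `f ↦ f dz` of `K(t)` with the relative differentials. -/
def IsCoord.equiv (hz : IsCoord x z) : RatFunc K ≃ₗ[RatFunc K] Ω[RatFunc K⁄K] :=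
  LinearEquiv.ofBijective
    (LinearMap.toSpanSingleton (RatFunc K) _ (KaehlerDifferential.D K (RatFunc K) z))
    ⟨LinearMap.ker_eq_bot.1 (LinearMap.ker_toSpanSingleton _ hz.D_ne_zero), fun w => by
      obtain ⟨f, hf⟩ := Submodule.mem_span_singleton.1 (hz.span_D w)
      exact ⟨f, hf⟩⟩

theorem IsCoord.equiv_apply (hz : IsCoord x z) (f : RatFunc K) :
    hz.equiv f = f • KaehlerDifferential.D K (RatFunc K) z := rfl

/-- The derivation `d/dz`. -/
def IsCoord.deriv (hz : IsCoord x z) : Derivation K (RatFunc K) (RatFunc K) :=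
  hz.equiv.symm.toLinearMap.compDer (KaehlerDifferential.D K (RatFunc K))

theorem IsCoord.D_eq (hz : IsCoord x z) (f : RatFunc K) :
    KaehlerDifferential.D K (RatFunc K) f = hz.deriv f • KaehlerDifferential.D K (RatFunc K) z := by
  rw [← hz.equiv_apply]
  exact (hz.equiv.apply_symm_apply _).symm

theorem IsCoord.deriv_eq_of_D_eq (hz : IsCoord x z) {f g : RatFunc K}
    (h : KaehlerDifferential.D K (RatFunc K) f = g • KaehlerDifferential.D K (RatFunc K) z) :
    hz.deriv f = g := by
  rw [← hz.equiv_apply] at h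
  exact (congrArg hz.equiv.symm h).trans (hz.equiv.symm_apply_apply g)

theorem IsCoord.deriv_self (hz : IsCoord x z) : hz.deriv z = 1 :=
  hz.deriv_eq_of_D_eq (one_smul _ _).symm

theorem IsCoord.val_deriv_le (hz : IsCoord x z) {f : RatFunc K} (hf : val x f ≤ 1) :
    val x (hz.deriv f) ≤ 1 := by
  obtain ⟨g, hg, h⟩ := hz.exists_of_mem_regForms_self (D_mem_regForms (k := K) hf)
  rwa [hz.deriv_eq_of_D_eq h]

theorem IsCoord.deriv_C (hz : IsCoord x z) (c : K) : hz.deriv (RatFunc.C c) = 0 :=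
  hz.deriv_eq_of_D_eq (by rw [D_C_eq_zero, zero_smul])

theorem IsCoord.deriv_zpow (hz : IsCoord x z) (n : ℤ) : hz.deriv (z ^ n) = n * z ^ (n - 1) := by
  rw [Derivation.leibniz_zpow, hz.deriv_self]
  simp

end Forms

/-! ### The relative connection in a local coordinate -/

section Local

variable {k K : Type*} [Field k] [Field K] [Algebra k K] {x : ClosedPoint K} {z : RatFunc K}
  {V : Type*} [AddCommGroup V] [Module (RatFunc K) V] {ι : Type*}

theorem Connection.rel_leibniz (N : Connection k K V) (f : RatFunc K) (v : V) :
    N.rel (f • v) = KaehlerDifferential.D K (RatFunc K) f ⊗ₜ[RatFunc K] v + f • N.rel v := by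
  simp only [Connection.rel, AddMonoidHom.comp_apply, LinearMap.toAddMonoidHom_coe, N.leibniz,
    map_add, map_smul, LinearMap.rTensor_tmul, KaehlerDifferential.map_D, Algebra.algebraMap_self,
    RingHom.id_apply]

/-- The isomorphism `v ↦ dz ⊗ v`. -/
def IsCoord.tensorEquiv (hz : IsCoord x z) (V : Type*) [AddCommGroup V] [Module (RatFunc K) V] :
    V ≃ₗ[RatFunc K] Ω[RatFunc K⁄K] ⊗[RatFunc K] V :=
  (TensorProduct.lid (RatFunc K) V).symm ≪≫ₗ hz.equiv.rTensor V

theorem IsCoord.tensorEquiv_apply (hz : IsCoord x z) (v : V) :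
    hz.tensorEquiv V v = KaehlerDifferential.D K (RatFunc K) z ⊗ₜ[RatFunc K] v := by
  simp [IsCoord.tensorEquiv, IsCoord.equiv_apply]

/-- The additive map `D : V → V` with `∇_{/K} v = dz ⊗ D v`. -/
def Connection.along (N : Connection k K V) (hz : IsCoord x z) : V →+ V :=
  (hz.tensorEquiv V).symm.toLinearMap.toAddMonoidHom.comp N.rel

theorem Connection.rel_eq (N : Connection k K V) (hz : IsCoord x z) (v : V) :
    N.rel v = KaehlerDifferential.D K (RatFunc K) z ⊗ₜ[RatFunc K] N.along hz v := by
  rw [← hz.tensorEquiv_apply]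
  exact ((hz.tensorEquiv V).apply_symm_apply _).symm

theorem Connection.along_eq_of_rel_eq (N : Connection k K V) (hz : IsCoord x z) {v w : V}
    (h : N.rel v = KaehlerDifferential.D K (RatFunc K) z ⊗ₜ[RatFunc K] w) :
    N.along hz v = w := by
  rw [← hz.tensorEquiv_apply] at h
  exact (congrArg (hz.tensorEquiv V).symm h).trans ((hz.tensorEquiv V).symm_apply_apply w)

theorem Connection.along_smul (N : Connection k K V) (hz : IsCoord x z) (f : RatFunc K) (v : V) :
    N.along hz (f • v) = hz.deriv f • v + f • N.along hz v := by
  apply N.along_eq_of_rel_eq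
  rw [N.rel_leibniz, hz.D_eq f, N.rel_eq hz v, TensorProduct.tmul_add, TensorProduct.tmul_smul,
    TensorProduct.tmul_smul]
  simp only [TensorProduct.smul_tmul']

theorem Connection.along_zpow_smul (N : Connection k K V) (hz : IsCoord x z) (n : ℤ) (v : V) :
    N.along hz (z ^ n • v) = ((n : RatFunc K) * z ^ (n - 1)) • v + z ^ n • N.along hz v := by
  rw [N.along_smul, hz.deriv_zpow]

/-- `dz` generates the regular relative forms at `x`. From here on, statements about relative forms
become statements about the poles of `D v`. -/
theorem IsCoord.tmul_mem_tens_twist_iff (hz : IsCoord x z) {S : Submodule (localRing x) V} {m : ℤ}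
    {v : V} :
    KaehlerDifferential.D K (RatFunc K) z ⊗ₜ[RatFunc K] v ∈ tens x (twist x m (regForms x K)) S ↔
      z ^ m • v ∈ S := by
  constructor
  · intro h
    have key : ∀ ξ ∈ tens x (twist x m (regForms x K)) S,
        z ^ m • (hz.tensorEquiv V).symm ξ ∈ S := by
      intro ξ hξ
      induction hξ using Submodule.span_induction with
      | mem ξ h =>
        obtain ⟨s, hs, e, he, rfl⟩ := h
        obtain ⟨f, hf, hsf⟩ := hz.exists_of_mem_regForms_self ((mem_twist_iff hz.isParam m).1 hs)
        rw [← map_smul, TensorProduct.smul_tmul', hsf, TensorProduct.smul_tmul,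
          ← hz.tensorEquiv_apply, LinearEquiv.symm_apply_apply]
        exact smul_mem_of_val_le hf he
      | zero => simp
      | add u v _ _ hu hv => rw [map_add, smul_add]; exact S.add_mem hu hv
      | smul c u _ hu =>
        change z ^ m • (hz.tensorEquiv V).symm (c.1 • u) ∈ S
        rw [map_smul, smul_comm]
        exact smul_mem_of_val_le c.2 hu
    have := key _ h
    rwa [← hz.tensorEquiv_apply, LinearEquiv.symm_apply_apply] at this
  · intro h
    refine Submodule.subset_span ⟨z ^ (-m) • KaehlerDifferential.D K (RatFunc K) z, ?_, _, h, ?_⟩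
    · refine (mem_twist_iff hz.isParam m).2 ?_
      rw [smul_smul, ← zpow_add₀ hz.isParam.ne_zero, add_neg_cancel,
        zpow_zero, one_smul]
      exact D_mem_regForms hz.isParam.val_lt_one.le
    · rw [TensorProduct.smul_tmul, smul_smul, ← zpow_add₀ hz.isParam.ne_zero, neg_add_cancel,
        zpow_zero, one_smul]

theorem IsCoord.mem_relForms_iff (hz : IsCoord x z) {E : VecBundle K V} {m : ℕ} {v : V} :
    KaehlerDifferential.D K (RatFunc K) z ⊗ₜ[RatFunc K] v ∈ relForms E x m ↔
      z ^ (m : ℤ) • v ∈ E.stalk x :=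
  hz.tmul_mem_tens_twist_iff

theorem IsCoord.exists_tmul_eq (hz : IsCoord x z) (ξ : Ω[RatFunc K⁄K] ⊗[RatFunc K] V) :
    ∃ v, ξ = KaehlerDifferential.D K (RatFunc K) z ⊗ₜ[RatFunc K] v :=
  ⟨(hz.tensorEquiv V).symm ξ, by rw [← hz.tensorEquiv_apply, LinearEquiv.apply_symm_apply]⟩

/-- The operator `z^m D - n z^(m-1)`, which is conjugate to `z^m D` under multiplication by `z^n`. -/
def Connection.shifted (N : Connection k K V) (hz : IsCoord x z) (m : ℕ) (n : ℤ) : V →+ V :=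
  (DistribSMul.toAddMonoidHom V (z ^ (m : ℤ))).comp (N.along hz) -
    DistribSMul.toAddMonoidHom V ((n : RatFunc K) * z ^ ((m : ℤ) - 1))

theorem Connection.shifted_apply (N : Connection k K V) (hz : IsCoord x z) (m : ℕ) (n : ℤ) (v : V) :
    N.shifted hz m n v =
      z ^ (m : ℤ) • N.along hz v - ((n : RatFunc K) * z ^ ((m : ℤ) - 1)) • v := rfl

theorem Connection.shifted_smul (N : Connection k K V) (hz : IsCoord x z) (m : ℕ) (n : ℤ)
    (f : RatFunc K) (v : V) :
    N.shifted hz m n (f • v) = (z ^ (m : ℤ) * hz.deriv f) • v + f • N.shifted hz m n v := by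
  rw [N.shifted_apply, N.shifted_apply, N.along_smul, smul_add, smul_smul, smul_sub,
    smul_comm f (z ^ (m : ℤ)), smul_comm f ((n : RatFunc K) * z ^ ((m : ℤ) - 1))]
  abel

/-- This is `D (z^c v) = c z^(c-1) v + z^c D v`. For `n = 0` and `c < 0` it says how `z^m D` acts on
a vector with a pole of order `-c`. -/
theorem Connection.shifted_zpow_smul (N : Connection k K V) (hz : IsCoord x z) (m : ℕ) (n c : ℤ)
    (v : V) : N.shifted hz m n (z ^ c • v) = z ^ c • N.shifted hz m (n - c) v := by
  rw [N.shifted_smul, hz.deriv_zpow, N.shifted_apply, N.shifted_apply]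
  have h1 : z ^ (m : ℤ) * (c * z ^ (c - 1)) = c * (z ^ c * z ^ ((m : ℤ) - 1)) := by
    rw [← zpow_add₀ hz.isParam.ne_zero, mul_left_comm, ← zpow_add₀ hz.isParam.ne_zero]
    congr 2
    ring
  rw [h1, Int.cast_sub, sub_mul, sub_smul, ← sub_add, smul_add, mul_left_comm, mul_smul (z ^ c),
    add_comm]

/-- The operator `z^m D - n z^(m-1)` is injective on `S / z S`. -/
def Connection.InjModAt (N : Connection k K V) (hz : IsCoord x z) (S : Submodule (localRing x) V)
    (m : ℕ) (n : ℤ) : Prop :=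
  ∀ e ∈ S, z ^ (-1 : ℤ) • N.shifted hz m n e ∈ S → z ^ (-1 : ℤ) • e ∈ S

variable {N : Connection k K V} {hz : IsCoord x z} {S : Submodule (localRing x) V}

theorem int_cast_mul_zpow_val_le (hz : IsCoord x z) (n : ℤ) {c : ℤ} (hc : 0 ≤ c) :
    val x ((n : RatFunc K) * z ^ c) ≤ 1 := by
  rw [map_mul]
  refine mul_le_one' ?_ ?_
  · simpa using val_C_le x (n : K)
  · rw [hz.isParam.val_zpow, ← exp_zero, exp_le_exp]
    omega

theorem Connection.shifted_mem {m : ℕ} (hm : m ≠ 0) (n : ℤ)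
    (hS : ∀ e ∈ S, z ^ (m : ℤ) • N.along hz e ∈ S) {e : V} (he : e ∈ S) :
    N.shifted hz m n e ∈ S := by
  rw [N.shifted_apply]
  exact S.sub_mem (hS e he) (smul_mem_of_val_le (int_cast_mul_zpow_val_le hz n (by omega)) he)

/-- The operator is not `𝒪_x`-linear, but `d/dz` kills constant vectors, so on these it acts through
`g`. A constant vector in the kernel of `g` modulo `𝔪_x` would contradict injectivity. -/
theorem Connection.InjModAt.isUnit_det [Fintype ι] [DecidableEq ι] {b : Module.Basis ι (RatFunc K) V}
    {m : ℕ} {n : ℤ}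
    (h : N.InjModAt hz (Submodule.span (localRing x) (Set.range b)) m n)
    {g : Matrix ι ι (localRing x)}
    (hg : ∀ j, N.shifted hz m n (b j) = ∑ i, (g i j : RatFunc K) • b i) : IsUnit g.det := by
  by_contra hdet
  obtain ⟨u, hu, hlt⟩ := exists_const_of_not_isUnit_det hz.isRational hdet
  apply hu
  obtain ⟨y, hy⟩ : ∃ y : ι → RatFunc K,
    ∀ i, y i = ∑ j, (g i j : RatFunc K) * RatFunc.C (u j) := ⟨_, fun _ => rfl⟩
  simp_rw [← hy] at hlt
  have hP : N.shifted hz m n (∑ j, RatFunc.C (u j) • b j) = ∑ i, y i • b i := by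
    simp_rw [hy, map_sum, N.shifted_smul, hz.deriv_C, hg, mul_zero, zero_smul, zero_add,
      Finset.smul_sum, Finset.sum_smul, smul_smul]
    rw [Finset.sum_comm]
    simp_rw [mul_comm]
  have := h (∑ j, RatFunc.C (u j) • b j) (by
    rw [mem_span_basis_iff]
    intro i
    rw [Module.Basis.repr_sum_self]
    exact val_C_le x _) (by
    rw [hP, mem_span_basis_iff]
    intro i
    rw [map_smul, Finsupp.smul_apply, Module.Basis.repr_sum_self,
      smul_eq_mul, ← exp_zero, hz.isParam.val_zpow_mul_le]
    exact le_exp_neg_one_iff.2 (hlt i))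
  rw [mem_span_basis_iff] at this
  funext i
  have hi := this i
  rw [map_smul, Finsupp.smul_apply, Module.Basis.repr_sum_self, smul_eq_mul, ← exp_zero,
    hz.isParam.val_zpow_mul_le] at hi
  by_contra h0
  exact absurd (le_exp_neg_one_iff.1 hi) (by rw [val_C x h0]; exact lt_irrefl _)

/-- An injective endomorphism of a finite dimensional fibre is onto. Solving with `g⁻¹` leaves only
the Leibniz terms `z^m f' b`, which vanish modulo `z` because `m ≥ 1`. -/
theorem Connection.InjModAt.exists_shifted [Finite ι] {b : Module.Basis ι (RatFunc K) V}
    {m : ℕ} (hm : m ≠ 0) {n : ℤ}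
    (h : N.InjModAt hz (Submodule.span (localRing x) (Set.range b)) m n)
    (hS : ∀ e ∈ Submodule.span (localRing x) (Set.range b),
      z ^ (m : ℤ) • N.along hz e ∈ Submodule.span (localRing x) (Set.range b))
    {w : V} (hw : w ∈ Submodule.span (localRing x) (Set.range b)) :
    ∃ e ∈ Submodule.span (localRing x) (Set.range b),
      z ^ (-1 : ℤ) • (w - N.shifted hz m n e) ∈ Submodule.span (localRing x) (Set.range b) := by
  classical
  have := Fintype.ofFinite ι
  have hmem : ∀ j, N.shifted hz m n (b j) ∈ Submodule.span (localRing x) (Set.range b) := fun j =>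
    N.shifted_mem hm n hS (Submodule.subset_span ⟨j, rfl⟩)
  let g : Matrix ι ι (localRing x) := fun i j =>
    ⟨b.repr (N.shifted hz m n (b j)) i, (mem_span_basis_iff b).1 (hmem j) i⟩
  have hg : ∀ j, N.shifted hz m n (b j) = ∑ i, (g i j : RatFunc K) • b i := fun j =>
    (b.sum_repr _).symm
  have hdet := h.isUnit_det hg
  let y : ι → localRing x := fun i => ⟨b.repr w i, (mem_span_basis_iff b).1 hw i⟩
  let f : ι → localRing x := g⁻¹.mulVec y
  have hf : g.mulVec f = y := by
    rw [Matrix.mulVec_mulVec, Matrix.mul_nonsing_inv _ hdet, Matrix.one_mulVec]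
  refine ⟨∑ j, (f j : RatFunc K) • b j, ?_, ?_⟩
  · exact Submodule.sum_mem _ fun i _ => smul_mem_of_val_le (f i).2 (Submodule.subset_span ⟨i, rfl⟩)
  · have hP : N.shifted hz m n (∑ j, (f j : RatFunc K) • b j) =
        (∑ j, (z ^ (m : ℤ) * hz.deriv (f j : RatFunc K)) • b j) + w := by
      simp_rw [map_sum, N.shifted_smul, hg, Finset.sum_add_distrib]
      congr 1
      simp_rw [Finset.smul_sum, smul_smul]
      rw [Finset.sum_comm]
      conv_rhs => rw [← b.sum_repr w]
      refine Finset.sum_congr rfl fun i _ => ?_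
      rw [← Finset.sum_smul]
      congr 1
      have := congrArg Subtype.val (congrFun hf i)
      simp only [Matrix.mulVec, dotProduct] at this
      push_cast at this
      rw [← show (y i : RatFunc K) = b.repr w i from rfl, ← this]
      exact Finset.sum_congr rfl fun j _ => mul_comm _ _
    rw [hP, sub_add_cancel_right, smul_neg, Submodule.neg_mem_iff, Finset.smul_sum]
    refine Submodule.sum_mem _ fun i _ => ?_
    rw [smul_smul, ← mul_assoc, ← zpow_add₀ hz.isParam.ne_zero]
    refine smul_mem_of_val_le ?_ (Submodule.subset_span ⟨i, rfl⟩)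
    rw [← exp_zero, hz.isParam.val_zpow_mul_le]
    refine (hz.val_deriv_le (f i).2).trans ?_
    rw [← exp_zero, exp_le_exp]
    omega

theorem exists_nat_zpow_smul_mem [Finite ι] (hz : IsParam x z) (b : Module.Basis ι (RatFunc K) V)
    (v : V) : ∃ n : ℕ, z ^ (n : ℤ) • v ∈ Submodule.span (localRing x) (Set.range b) := by
  have := Fintype.ofFinite ι
  choose n hn using fun i => exists_nat_le_exp (val x (b.repr v i))
  refine ⟨∑ i, n i, (mem_span_basis_iff b).2 fun i => ?_⟩
  rw [map_smul, Finsupp.smul_apply, smul_eq_mul, ← exp_zero, hz.val_zpow_mul_le]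
  refine (hn i).trans ?_
  rw [exp_le_exp, zero_add]
  exact_mod_cast Finset.single_le_sum (f := n) (fun _ _ => Nat.zero_le _) (Finset.mem_univ i)

/-- Descent on the pole order: for `e = z^(n+1) v` in `S`, the shifted operator gives `z^(n+1) (z^m
D v)`, which lies in `z S`. Hence `e ∈ z S` and the pole order of `v` drops. -/
theorem Connection.mem_of_zpow_smul_along_mem {m : ℕ} (h : ∀ n : ℕ, N.InjModAt hz S m (n + 1))
    (n : ℕ) {v : V} (hv : z ^ (n : ℤ) • v ∈ S) (hD : z ^ (m : ℤ) • N.along hz v ∈ S) : v ∈ S := by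
  induction n with
  | zero => simpa using hv
  | succ n ih =>
    refine ih ?_
    have h1 := h n _ hv (by
      push_cast
      rw [N.shifted_zpow_smul, sub_self, N.shifted_apply, smul_smul, ← zpow_add₀ hz.isParam.ne_zero]
      simp only [Int.cast_zero, zero_mul, zero_smul, sub_zero]
      refine hz.isParam.zpow_smul_mem (a := 0) (by omega) (by simpa using hD))
    rw [smul_smul, ← zpow_add₀ hz.isParam.ne_zero] at h1
    convert h1 using 3
    push_cast
    ring

/-- Descent on the pole order: the leading term of `w` is cancelled by `D (z^(-(n+1)) e)`, where `e`
is a preimage modulo `z` of `z^(n+1+m) w` under the operator shifted by `n + 1`. -/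
theorem Connection.exists_add_along_eq [Finite ι] {b : Module.Basis ι (RatFunc K) V} {m : ℕ}
    (hm : m ≠ 0) (h : ∀ n : ℕ, N.InjModAt hz (Submodule.span (localRing x) (Set.range b)) m (n + 1))
    (hS : ∀ e ∈ Submodule.span (localRing x) (Set.range b),
      z ^ (m : ℤ) • N.along hz e ∈ Submodule.span (localRing x) (Set.range b))
    (n : ℕ) {w : V} (hw : z ^ ((n : ℤ) + m) • w ∈ Submodule.span (localRing x) (Set.range b)) :
    ∃ a v : V, z ^ (m : ℤ) • a ∈ Submodule.span (localRing x) (Set.range b) ∧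
      w = a + N.along hz v := by
  induction n generalizing w with
  | zero => exact ⟨w, 0, by simpa using hw, by simp⟩
  | succ n ih =>
    obtain ⟨e, he, h1⟩ := (h n).exists_shifted hm hS hw
    obtain ⟨a, v, ha, hav⟩ := ih (w := w - N.along hz (z ^ (-((n : ℤ) + 1)) • e)) (by
      convert h1 using 1
      have e1 : z ^ (m : ℤ) • N.along hz (z ^ (-((n : ℤ) + 1)) • e) =
          z ^ (-((n : ℤ) + 1)) • N.shifted hz m (n + 1) e := by
        have := N.shifted_zpow_smul hz m 0 (-((n : ℤ) + 1)) e
        rw [N.shifted_apply] at this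
        simpa using this
      rw [zpow_add₀ hz.isParam.ne_zero, mul_smul, smul_sub, e1, smul_sub, smul_sub,
        smul_smul, smul_smul, smul_smul, ← zpow_add₀ hz.isParam.ne_zero,
        ← zpow_add₀ hz.isParam.ne_zero, ← zpow_add₀ hz.isParam.ne_zero]
      push_cast
      congr 3 <;> ring)
    exact ⟨a, v + z ^ (-((n : ℤ) + 1)) • e, ha, by
      rw [map_add, ← add_assoc, ← hav, sub_add_cancel]⟩

end Local

/-! ### Stalks of push-forwards and local quasi-isomorphisms -/

section Bundles

variable {K : Type*} [Field K] {V : Type*} [AddCommGroup V] [Module (RatFunc K) V]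

/-- A neighbourhood of `x` can avoid the finitely many other points where `m` is not a section.
Hence the only possible condition is the one at `x`, and there is none if `x ∉ W`. -/
theorem mem_pushStalk_iff {M : Type*} [AddCommGroup M] {W : Set (ClosedPoint K)}
    {S : ClosedPoint K → AddSubgroup M} {x : ClosedPoint K} {m : M}
    (hfin : {y | m ∉ S y}.Finite) : m ∈ pushStalk W S x ↔ (x ∈ W → m ∈ S x) := by
  constructor
  · rintro ⟨T, -, hx, h⟩ hxW
    exact h x hxW hx
  · intro h
    refine ⟨{y | m ∉ S y} \ {x}, hfin.subset Set.sdiff_subset, by simp, fun y hy hyT => ?_⟩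
    by_contra hm
    rcases eq_or_ne y x with rfl | hyx
    · exact hm (h hy)
    · exact hyT ⟨hm, hyx⟩

theorem VecBundle.finite_notMem (E : VecBundle K V) (v : V) : {x | v ∉ E.stalk x}.Finite := by
  obtain ⟨b, hb⟩ := E.coherent
  have h : (⋃ i, {x : ClosedPoint K | ¬ val x (b.repr v i) ≤ 1}).Finite :=
    Set.finite_iUnion fun i => finite_val_not_le _
  refine (hb.union h).subset fun x hx => ?_
  by_contra hn
  simp only [Set.mem_union, Set.mem_ofPred_eq, Set.mem_iUnion, not_or, not_not, not_exists] at hn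
  apply hx
  rw [hn.1, mem_span_basis_iff]
  exact hn.2

/-- Writing `ξ = dt ⊗ v`, with `dt` regular on the affine line, leaves only infinity and the points
where `v` is not a section. -/
theorem VecBundle.finite_notMem_relForms (E : VecBundle K V)
    (ξ : Ω[RatFunc K⁄K] ⊗[RatFunc K] V) : {x | ξ ∉ relForms E x 0}.Finite := by
  obtain ⟨v, rfl⟩ := (isCoord_pt (0 : K)).exists_tmul_eq ξ
  refine ((E.finite_notMem v).union (Set.finite_singleton none)).subset fun x hx => ?_
  by_contra hn
  simp only [Set.mem_union, Set.mem_ofPred_eq, Set.mem_singleton_iff, not_or, not_not] at hn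
  apply hx
  refine Submodule.subset_span ⟨_, Submodule.subset_span ⟨1, by simp, _, D_mem_regForms ?_,
    (one_smul _ _).symm⟩, v, hn.1, rfl⟩
  cases x with
  | none => exact absurd rfl hn.2
  | some w => exact val_algebraMap_le w _

variable {k : Type*} [Field k] [Algebra k K]

theorem map_constForms {x : ClosedPoint K} {w : Ω[RatFunc K⁄k]} (hw : w ∈ constForms x k) :
    KaehlerDifferential.map k K (RatFunc K) (RatFunc K) w = 0 := by
  induction hw using Submodule.span_induction with
  | mem w hw =>
    obtain ⟨c, rfl⟩ := hw
    rw [KaehlerDifferential.map_D]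
    exact D_C_eq_zero c
  | zero => simp
  | add u v _ _ hu hv => rw [map_add, hu, hv, add_zero]
  | smul c u _ hu =>
    have e : KaehlerDifferential.map k K (RatFunc K) (RatFunc K) (c • u) =
        c.1 • KaehlerDifferential.map k K (RatFunc K) (RatFunc K) u :=
      map_smul (KaehlerDifferential.map k K (RatFunc K) (RatFunc K)) c.1 u
    rw [e, hu, smul_zero]

theorem map_mem_twist_of_mem_curlyForms {x : ClosedPoint K} {m : ℕ} {w : Ω[RatFunc K⁄k]}
    (hw : w ∈ curlyForms x k m) :
    KaehlerDifferential.map k K (RatFunc K) (RatFunc K) w ∈ twist x m (regForms x K) := by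
  have hreg : ∀ w ∈ regForms x k,
      KaehlerDifferential.map k K (RatFunc K) (RatFunc K) w ∈ regForms x K := by
    intro w hw
    induction hw using Submodule.span_induction with
    | mem w hw =>
      obtain ⟨f, hf, rfl⟩ := hw
      rw [KaehlerDifferential.map_D]
      exact D_mem_regForms hf
    | zero => simp
    | add u v _ _ hu hv => rw [map_add]; exact Submodule.add_mem _ hu hv
    | smul c u _ hu =>
      have e : KaehlerDifferential.map k K (RatFunc K) (RatFunc K) (c • u) =
          c.1 • KaehlerDifferential.map k K (RatFunc K) (RatFunc K) u :=
        map_smul (KaehlerDifferential.map k K (RatFunc K) (RatFunc K)) c.1 u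
      rw [e]
      exact smul_mem_of_val_le c.2 hu
  rw [curlyForms] at hw
  split_ifs at hw with hm
  · subst hm
    exact Submodule.subset_span ⟨1, by simp, _, hreg w hw, (one_smul _ _).symm⟩
  · induction hw using Submodule.span_induction with
    | mem w hw =>
      obtain ⟨z, hz, f, hf, η, hη, rfl⟩ := hw
      refine (mem_twist_iff hz m).2 ?_
      rw [map_add, map_smul, map_smul, map_constForms hη, smul_zero, add_zero, KaehlerDifferential.map_D,
        smul_smul, zpow_natCast, mul_div_cancel₀ _ (pow_ne_zero _ hz.ne_zero)]
      exact smul_mem_of_val_le hf (D_mem_regForms hz.val_lt_one.le)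
    | zero => simp
    | add u v _ _ hu hv => rw [map_add]; exact Submodule.add_mem _ hu hv
    | smul c u _ hu =>
      have e : KaehlerDifferential.map k K (RatFunc K) (RatFunc K) (c • u) =
          c.1 • KaehlerDifferential.map k K (RatFunc K) (RatFunc K) u :=
        map_smul (KaehlerDifferential.map k K (RatFunc K) (RatFunc K)) c.1 u
      rw [e]
      exact smul_mem_of_val_le c.2 hu

theorem HasPolesAt.rel_mem {E : VecBundle K V} {N : Connection k K V} {x : ClosedPoint K} {m : ℕ}
    (h : HasPolesAt E N x m) {e : V} (he : e ∈ E.stalk x) : N.rel e ∈ relForms E x m := by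
  obtain ⟨b, hb⟩ := E.locallyFree x
  have h1 := h e he
  rw [hb] at h1
  obtain ⟨s, hs, hN⟩ := (mem_tens_span_iff b).1 h1
  rw [relForms, hb]
  refine (mem_tens_span_iff b).2 ⟨fun i => KaehlerDifferential.map k K (RatFunc K) (RatFunc K) (s i),
    fun i => map_mem_twist_of_mem_curlyForms (hs i), ?_⟩
  simp [Connection.rel, hN]

theorem HasPolesAt.along_mem {E : VecBundle K V} {N : Connection k K V} {x : ClosedPoint K} {m : ℕ}
    (h : HasPolesAt E N x m) {z : RatFunc K} (hz : IsCoord x z) (e : V) (he : e ∈ E.stalk x) :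
    z ^ (m : ℤ) • N.along hz e ∈ E.stalk x := by
  rw [← hz.mem_relForms_iff, ← N.rel_eq hz]
  exact h.rel_mem he

theorem isQuasiIsoInclusion_self {M M' : Type*} [AddCommGroup M] [AddCommGroup M'] {d : M →+ M'}
    {A : AddSubgroup M} {B : AddSubgroup M'} (h : ∀ a ∈ A, d a ∈ B) :
    IsQuasiIsoInclusion d A A B B where
  le_zero := le_rfl
  le_one := le_rfl
  map_sub := h
  map_big := h
  surj_H0 _ hb _ := hb
  inj_H1 _ _ h := h
  surj_H1 b hb := ⟨b, hb, 0, A.zero_mem, by simp⟩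

theorem isQuasiIsoInclusion_of_injModAt {L : VecBundle K V} {N : Connection k K V}
    {x : ClosedPoint K} {z : RatFunc K} (hz : IsCoord x z) {m : ℕ} (hm : m ≠ 0)
    (hS : ∀ e ∈ L.stalk x, z ^ (m : ℤ) • N.along hz e ∈ L.stalk x)
    (h : ∀ n : ℕ, N.InjModAt hz (L.stalk x) m (n + 1)) :
    IsQuasiIsoInclusion N.rel (L.stalk x).toAddSubgroup ⊤ (relForms L x m).toAddSubgroup ⊤ := by
  obtain ⟨b, hb⟩ := L.locallyFree x
  -- This one statement gives both the comparison of kernels and injectivity on cokernels.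
  have key : ∀ v, N.rel v ∈ relForms L x m → v ∈ L.stalk x := by
    intro v hv
    rw [N.rel_eq hz, hz.mem_relForms_iff] at hv
    obtain ⟨n, hn⟩ := exists_nat_zpow_smul_mem hz.isParam b v
    rw [← hb] at hn
    exact N.mem_of_zpow_smul_along_mem h n hn hv
  refine ⟨le_top, le_top, fun e he => ?_, fun _ _ => trivial, fun v _ hv => ?_, ?_, fun ξ _ => ?_⟩
  · change N.rel e ∈ relForms L x m
    rw [N.rel_eq hz, hz.mem_relForms_iff]
    exact hS e he
  · exact key v (by rw [hv]; exact Submodule.zero_mem _)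
  · rintro ξ hξ ⟨v, -, rfl⟩
    exact ⟨v, key v hξ, rfl⟩
  · obtain ⟨w, rfl⟩ := hz.exists_tmul_eq ξ
    obtain ⟨n, hn⟩ := exists_nat_zpow_smul_mem hz.isParam b w
    rw [hb] at h hS
    obtain ⟨a, v, ha, rfl⟩ := N.exists_add_along_eq hm h hS n
      (hz.isParam.zpow_smul_mem (by omega) hn)
    rw [← hb] at ha
    refine ⟨KaehlerDifferential.D K (RatFunc K) z ⊗ₜ[RatFunc K] a, hz.mem_relForms_iff.2 ha, v,
      trivial, ?_⟩
    rw [N.rel_eq hz, ← TensorProduct.tmul_add]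

end Bundles

/-! ### Admissible points -/

section Admissible

variable {k K : Type*} [Field k] [Field K] [Algebra k K] {x : ClosedPoint K} {z : RatFunc K}
  {V : Type*} [AddCommGroup V] [Module (RatFunc K) V] {N : Connection k K V} {E : VecBundle K V}

/-- Changing `n` adds a multiple of `z^(m-1)`, which is zero modulo `z` once `m ≥ 2`. This is the
property of irregular points that makes twisting free. -/
theorem Connection.InjModAt.of_two_le {hz : IsCoord x z} {S : Submodule (localRing x) V} {m : ℕ}
    (hm : 2 ≤ m) {n : ℤ} (h : N.InjModAt hz S m n) (n' : ℤ) : N.InjModAt hz S m n' := by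
  intro e he h1
  refine h e he ?_
  have e1 : N.shifted hz m n e =
      N.shifted hz m n' e + (((n' - n : ℤ) : RatFunc K) * z ^ ((m : ℤ) - 1)) • e := by
    rw [N.shifted_apply, N.shifted_apply, Int.cast_sub, sub_mul, sub_smul]
    abel
  rw [e1, smul_add]
  refine S.add_mem h1 ?_
  rw [smul_smul, mul_left_comm, ← zpow_add₀ hz.isParam.ne_zero]
  exact smul_mem_of_val_le (int_cast_mul_zpow_val_le hz _ (by omega)) he

theorem PolarPartIso.injModAt {m : ℕ} (h : PolarPartIso E N x m) (hm : 2 ≤ m) (hz : IsCoord x z)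
    (n : ℤ) : N.InjModAt hz (E.stalk x) m n := by
  refine Connection.InjModAt.of_two_le (n := 0) hm (fun e he h1 => ?_) n
  have hz0 := hz.isParam.ne_zero
  rw [N.shifted_apply, Int.cast_zero, zero_mul, zero_smul, sub_zero, smul_smul,
    ← zpow_add₀ hz0] at h1
  -- If `z^m D e ∈ z S`, then `z^(m-1) e` has regular derivative, so it lies in the kernel of the
  -- polar part map. The kernel being trivial, it lies in `z^m S`, so `e ∈ z S`.
  have h2 := h.1 (z ^ ((m : ℤ) - 1) • e)
    (hz.isParam.zpow_smul_mem (a := 0) (by omega) (by simpa using he)) (by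
      rw [N.rel_eq hz, hz.mem_relForms_iff, N.along_zpow_smul, Nat.cast_zero, zpow_zero, one_smul]
      refine Submodule.add_mem _ (smul_mem_of_val_le
        (int_cast_mul_zpow_val_le hz _ (by omega)) he) ?_
      rwa [add_comm] at h1)
  rw [mem_twist_iff hz.isParam, smul_smul, ← zpow_add₀ hz0] at h2
  convert h2 using 3
  ring

/-- The converse of `PolarPartIso.injModAt`, used to recover admissibility after a twist. In the
filtration by powers of `z`, the graded pieces of the polar part map are the shifted operators. The
kernel is pushed into `z^m S` one power at a time, and preimages are found by lowering the pole
order one step at a time. -/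
theorem polarPartIso_of_injModAt {m : ℕ} (hm : 2 ≤ m) (hz : IsCoord x z)
    (hS : ∀ e ∈ E.stalk x, z ^ (m : ℤ) • N.along hz e ∈ E.stalk x)
    (h : ∀ n, N.InjModAt hz (E.stalk x) m n) : PolarPartIso E N x m := by
  have hz0 := hz.isParam.ne_zero
  constructor
  · intro e he h1
    rw [N.rel_eq hz, hz.mem_relForms_iff, Nat.cast_zero, zpow_zero, one_smul] at h1
    refine (mem_twist_iff hz.isParam _).2 ?_
    have key : ∀ j : ℕ, j ≤ m → z ^ (-(j : ℤ)) • e ∈ E.stalk x := by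
      intro j hj
      induction j with
      | zero => simpa using he
      | succ j ih =>
        have h2 := h (-j) _ (ih (by omega)) (by
          have e1 := N.shifted_zpow_smul hz m (-j) (-j) e
          rw [e1, sub_self, N.shifted_apply, Int.cast_zero, zero_mul, zero_smul, sub_zero,
            smul_smul, smul_smul, ← zpow_add₀ hz0, ← zpow_add₀ hz0]
          exact hz.isParam.zpow_smul_mem (a := 0) (by omega) (by simpa using h1))
        rw [smul_smul, ← zpow_add₀ hz0] at h2
        convert h2 using 3
        push_cast
        ring
    exact key m le_rfl
  · obtain ⟨b, hb⟩ := E.locallyFree x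
    have key : ∀ j : ℕ, j ≤ m → ∀ w, z ^ (j : ℤ) • w ∈ E.stalk x →
        ∃ e ∈ E.stalk x, w - N.along hz e ∈ E.stalk x := by
      intro j
      induction j with
      | zero => exact fun _ w hw => ⟨0, Submodule.zero_mem _, by simpa using hw⟩
      | succ j ih =>
        intro hj w hw
        have h0 := h (-((m : ℤ) - (j + 1)))
        rw [hb] at h0 hS hw
        obtain ⟨f, hf, h1⟩ := h0.exists_shifted (by omega) hS hw
        rw [← hb] at hf h1 hw
        have hf' : z ^ ((m : ℤ) - (j + 1)) • f ∈ E.stalk x :=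
          hz.isParam.zpow_smul_mem (a := 0) (by omega) (by simpa using hf)
        obtain ⟨e, he, h2⟩ := ih (by omega) (w - N.along hz (z ^ ((m : ℤ) - (j + 1)) • f)) (by
          convert h1 using 1
          have e1 : z ^ (m : ℤ) • N.along hz (z ^ ((m : ℤ) - (j + 1)) • f) =
              z ^ ((m : ℤ) - (j + 1)) • N.shifted hz m (-((m : ℤ) - (j + 1))) f := by
            have := N.shifted_zpow_smul hz m 0 ((m : ℤ) - (j + 1)) f
            rw [N.shifted_apply] at this
            simpa using this
          have e2 : z ^ (j : ℤ) • N.along hz (z ^ ((m : ℤ) - (j + 1)) • f) =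
              z ^ (-1 : ℤ) • N.shifted hz m (-((m : ℤ) - (j + 1))) f := by
            have := congrArg (fun v => z ^ ((j : ℤ) - m) • v) e1
            simp only [smul_smul, ← zpow_add₀ hz0] at this
            convert this using 3 <;> ring
          rw [smul_sub, smul_sub, e2, smul_smul, ← zpow_add₀ hz0]
          congr 3
          push_cast
          ring)
        exact ⟨e + z ^ ((m : ℤ) - (j + 1)) • f, Submodule.add_mem _ he hf', by
          rw [map_add, add_comm (N.along hz e), ← sub_sub]; exact h2⟩
    intro ξ hξ
    obtain ⟨w, rfl⟩ := hz.exists_tmul_eq ξ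
    obtain ⟨e, he, h1⟩ := key m le_rfl w (hz.mem_relForms_iff.1 hξ)
    refine ⟨e, he, ?_⟩
    rw [N.rel_eq hz, ← TensorProduct.tmul_sub, hz.mem_relForms_iff]
    simpa using h1

/-- For `m = 1` the shifted operator is `z D - n`, which induces the residue minus `n` on the fibre.
-/
theorem DeligneCondition.injModAt (h : DeligneCondition E N x) (hz : IsCoord x z) (n : ℕ) :
    N.InjModAt hz (E.stalk x) 1 n := by
  intro e he h1
  have := h z hz.isParam n e he (by
    rw [N.rel_eq hz, ← TensorProduct.tmul_smul, ← TensorProduct.tmul_sub, hz.mem_relForms_iff]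
    rw [N.shifted_apply, smul_sub, smul_smul, smul_smul] at h1
    simpa [hz.isParam.ne_zero, mul_comm] using h1)
  exact (mem_twist_iff hz.isParam _).1 this

theorem IsAdmissibleAt.injModAt {m : ℕ} (h : IsAdmissibleAt E N x m) (hm : m ≠ 0)
    (hz : IsCoord x z) (n : ℕ) : N.InjModAt hz (E.stalk x) m n := by
  rcases Nat.lt_or_ge m 2 with h2 | h2
  · obtain rfl : m = 1 := by omega
    exact (h.2.2 rfl).injModAt hz n
  · exact (h.2.1 h2).injModAt h2 hz n

theorem D_zpow (n : ℤ) : KaehlerDifferential.D k (RatFunc K) (z ^ n) =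
    ((n : RatFunc K) * z ^ (n - 1)) • KaehlerDifferential.D k (RatFunc K) z := by
  rw [Derivation.leibniz_zpow, ← Int.cast_smul_eq_zsmul (RatFunc K), smul_smul]

/-- Twisting by multiples of `x` preserves admissibility at a point of multiplicity at least two. -/
theorem IsAdmissibleAt.twist {m : ℕ} (h : IsAdmissibleAt E N x m) (hm : 2 ≤ m) (hz : IsCoord x z)
    {L : VecBundle K V} {c : ℤ} (hL : ∀ v, v ∈ L.stalk x ↔ z ^ c • v ∈ E.stalk x) :
    IsAdmissibleAt L N x m := by
  have hz0 := hz.isParam.ne_zero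
  have hLE : ∀ f ∈ E.stalk x, z ^ (-c) • f ∈ L.stalk x := by
    intro f hf
    rw [hL, smul_smul, ← zpow_add₀ hz0]
    simpa using hf
  have hpoles : HasPolesAt L N x m := by
    intro e he
    have he' := (hL e).1 he
    have e1 : e = z ^ (-c) • z ^ c • e := by
      rw [smul_smul, ← zpow_add₀ hz0]
      simp
    rw [e1, N.leibniz]
    refine Submodule.add_mem _ ?_ (smul_mem_tens hLE (h.1 _ he'))
    -- The new term is the logarithmic derivative of `z^(-c)`, namely `-c dz/z = (-c z^(m-1))
    -- dz/z^m`, with `η = 0`.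
    refine Submodule.subset_span ⟨_, hz.isParam.mem_curlyForms (k := k) (by omega : m ≠ 0)
      (f := ((-c : ℤ) : RatFunc K) * z ^ ((m : ℤ) - 1))
      (int_cast_mul_zpow_val_le hz _ (by omega)) (Submodule.zero_mem _), e, he, ?_⟩
    rw [D_zpow, smul_zero, add_zero, ← TensorProduct.smul_tmul, smul_smul]
    congr 2
    rw [mul_left_comm, mul_div_assoc, ← zpow_add₀ hz0, ← zpow_natCast, ← zpow_sub₀ hz0]
    congr 2
    ring
  refine ⟨hpoles, fun _ => ?_, fun h1 => by omega⟩
  refine polarPartIso_of_injModAt hm hz (hpoles.along_mem hz) fun n e he h1 => ?_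
  -- Conjugation by `z^c` turns the shift `n` on `L` into `n + c` on `E`. Either sign is allowed
  -- here, since at `m ≥ 2` injectivity holds for every integer shift.
  have h2 := (h.2.1 hm).injModAt hm hz (n + c) _ ((hL e).1 he) (by
    rw [N.shifted_zpow_smul, add_sub_cancel_right, smul_comm]
    exact (hL _).1 h1)
  rw [hL, smul_comm]
  exact h2

theorem HasMatrix.along_eq {ι : Type*} [Fintype ι] (hz : IsCoord x z)
    {b : Module.Basis ι (RatFunc K) V} {f : Matrix ι ι (RatFunc K)} {θ : Matrix ι ι Ω[RatFunc K⁄k]}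
    (hθ : ∀ i j, KaehlerDifferential.map k K (RatFunc K) (RatFunc K) (θ i j) = 0)
    (hN : HasMatrix N b (Matrix.of fun i j =>
      f i j • KaehlerDifferential.D k (RatFunc K) z + θ i j)) (j : ι) :
    N.along hz (b j) = ∑ i, f i j • b i := by
  apply N.along_eq_of_rel_eq
  simp only [Connection.rel, AddMonoidHom.comp_apply, LinearMap.toAddMonoidHom_coe, hN j, map_sum,
    LinearMap.rTensor_tmul, Matrix.of_apply, map_add, map_smul, hθ, add_zero,
    KaehlerDifferential.map_D, Algebra.algebraMap_self, RingHom.id_apply, TensorProduct.tmul_sum,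
    TensorProduct.smul_tmul]

/-- `g` is the matrix of `z D`, so injectivity for the shift `0` is what makes it invertible. -/
theorem isPseudoLogAt_of_injModAt (hz : IsCoord x z)
    {b : Module.Basis (Fin (Module.finrank (RatFunc K) V)) (RatFunc K) V}
    (hb : E.stalk x = Submodule.span (localRing x) (Set.range b))
    {g : Matrix (Fin (Module.finrank (RatFunc K) V)) (Fin (Module.finrank (RatFunc K) V))
      (RatFunc K)} (hg : ∀ i j, val x (g i j) ≤ 1)
    {η : Matrix (Fin (Module.finrank (RatFunc K) V)) (Fin (Module.finrank (RatFunc K) V))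
      Ω[RatFunc K⁄k]} (hη : ∀ i j, η i j ∈ constForms x k)
    (hN : HasMatrix N b (Matrix.of fun i j =>
      (g i j * z⁻¹) • KaehlerDifferential.D k (RatFunc K) z + z⁻¹ • η i j))
    (h : N.InjModAt hz (E.stalk x) 1 0) : IsPseudoLogAt E N x := by
  have hz0 := hz.isParam.ne_zero
  let G : Matrix (Fin (Module.finrank (RatFunc K) V)) (Fin (Module.finrank (RatFunc K) V))
    (localRing x) := fun i j => ⟨g i j, hg i j⟩
  have hG : IsUnit G.det := by
    rw [hb] at h
    refine h.isUnit_det fun j => ?_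
    rw [N.shifted_apply, HasMatrix.along_eq hz (fun i j => by
      rw [map_smul, map_constForms (hη i j), smul_zero]) hN, Finset.smul_sum]
    simp only [Int.cast_zero, zero_mul, zero_smul, sub_zero, smul_smul, Nat.cast_one, zpow_one]
    refine Finset.sum_congr rfl fun i _ => ?_
    rw [mul_left_comm, mul_inv_cancel₀ hz0, mul_one]
  exact ⟨z, hz.isParam, b, hb, Matrix.GeneralLinearGroup.mk'' G hG, η, hη, hN⟩

theorem HasPolesAt.isPseudoLogAt (h : HasPolesAt E N x 1) (hz : IsCoord x z)
    (hinj : N.InjModAt hz (E.stalk x) 1 0) : IsPseudoLogAt E N x := by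
  obtain ⟨b, hb⟩ := E.locallyFree x
  have hN : ∀ j, ∃ s : Fin (Module.finrank (RatFunc K) V) → Ω[RatFunc K⁄k],
      (∀ i, s i ∈ curlyForms x k 1) ∧
      N.toHom (b j) = ∑ i, s i ⊗ₜ[RatFunc K] b i := fun j => by
    have := h (b j) (by rw [hb]; exact Submodule.subset_span ⟨j, rfl⟩)
    rw [hb] at this
    exact (mem_tens_span_iff b).1 this
  choose s hs hNs using hN
  choose f hf η hη hsf using fun j i => hz.exists_of_mem_curlyForms one_ne_zero (hs j i)
  refine isPseudoLogAt_of_injModAt hz hb (g := fun i j => f j i) (fun i j => hf j i)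
    (η := fun i j => z • η j i)
    (fun i j => smul_mem_of_val_le hz.isParam.val_lt_one.le (hη j i)) (fun j => ?_) hinj
  rw [hNs]
  refine Finset.sum_congr rfl fun i _ => ?_
  rw [hsf, Matrix.of_apply, smul_smul, inv_mul_cancel₀ hz.isParam.ne_zero]
  simp [div_eq_mul_inv]

theorem IsAdmissibleAt.isPseudoLogAt (h : IsAdmissibleAt E N x 1) (hx : IsRational x) :
    IsPseudoLogAt E N x := by
  obtain ⟨z, hz⟩ := hx.exists_isCoord
  exact h.1.isPseudoLogAt hz (h.injModAt one_ne_zero hz 0)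

end Admissible

/-! ### Modification at a regular point -/

section Modification

variable {k K : Type*} [Field k] [Field K] [Algebra k K] {x : ClosedPoint K} {z : RatFunc K}
  {V : Type*} [AddCommGroup V] [Module (RatFunc K) V] {N : Connection k K V} {ι : Type*}

theorem Connection.zpow_smul_along_mem_span [Finite ι] (hz : IsCoord x z)
    (b : Module.Basis ι (RatFunc K) V) {m : ℕ}
    (h : ∀ j, z ^ (m : ℤ) • N.along hz (b j) ∈ Submodule.span (localRing x) (Set.range b))
    {e : V} (he : e ∈ Submodule.span (localRing x) (Set.range b)) :
    z ^ (m : ℤ) • N.along hz e ∈ Submodule.span (localRing x) (Set.range b) := by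
  have := Fintype.ofFinite ι
  rw [mem_span_basis_iff] at he
  rw [← b.sum_repr e, map_sum, Finset.smul_sum]
  refine Submodule.sum_mem _ fun i _ => ?_
  rw [N.along_smul, smul_add, smul_comm _ (b.repr e i)]
  refine Submodule.add_mem _ ?_ (smul_mem_of_val_le (he i) (h i))
  exact hz.isParam.zpow_smul_mem (a := 0) (by omega) (by
    rw [zpow_zero, one_smul]
    exact smul_mem_of_val_le (hz.val_deriv_le (he i)) (Submodule.subset_span ⟨i, rfl⟩))

/-- A connection that is regular at `x`, in the basis `z^{aᵢ} bᵢ`. -/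
theorem hasMatrix_scale [Fintype ι] [DecidableEq ι] (hz : z ≠ 0) {b : Module.Basis ι (RatFunc K) V}
    {A : Matrix ι ι Ω[RatFunc K⁄k]} (hA : HasMatrix N b A) (a : ι → ℤ) :
    HasMatrix N (scale b (fun i => z ^ a i) fun _ => zpow_ne_zero _ hz)
      ((Matrix.of fun i j => z ^ (a j - a i) • A i j) + Matrix.diagonal fun i =>
        ((a i : RatFunc K) * z⁻¹) • KaehlerDifferential.D k (RatFunc K) z) := by
  intro j
  simp only [scale_apply, N.leibniz, hA j, D_zpow, Matrix.add_apply, Matrix.of_apply,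
    TensorProduct.add_tmul, Finset.sum_add_distrib]
  rw [add_comm]
  congr 1
  · rw [Finset.smul_sum]
    refine Finset.sum_congr rfl fun i _ => ?_
    rw [TensorProduct.smul_tmul, smul_smul, ← zpow_add₀ hz, sub_add_cancel,
      TensorProduct.tmul_smul]
  · rw [Finset.sum_eq_single j]
    · rw [Matrix.diagonal_apply_eq, TensorProduct.tmul_smul, TensorProduct.smul_tmul', smul_smul]
      congr 2
      rw [zpow_sub_one₀ hz]
      ring
    · intro i _ hij
      rw [Matrix.diagonal_apply_ne _ hij, TensorProduct.zero_tmul]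
    · simp

theorem HasMatrix.reindex {ι' : Type*} [Fintype ι] [Fintype ι'] {b : Module.Basis ι (RatFunc K) V}
    {A : Matrix ι ι Ω[RatFunc K⁄k]} (hA : HasMatrix N b A) (e : ι ≃ ι') :
    HasMatrix N (b.reindex e) (A.submatrix e.symm e.symm) := by
  intro j
  rw [Module.Basis.reindex_apply, hA, ← Equiv.sum_comp e.symm]
  simp

/-- Modulo `z` the operator `z D - n` is block triangular with diagonal entries `aᵢ - n`, which are
negative integers and hence units in characteristic zero. Rows with `aᵢ = -2` have all other
coefficients divisible by `z`, which forces `yᵢ` to vanish at `x`. In rows with `aᵢ = -1` the only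
coefficients not divisible by `z` multiply these `yⱼ`. -/
theorem injModAt_scale [CharZero K] [Fintype ι] (hz : IsCoord x z) (b : Module.Basis ι (RatFunc K) V)
    {f : Matrix ι ι (RatFunc K)} (hf : ∀ i j, val x (f i j) ≤ 1)
    {a : ι → ℤ} (ha : ∀ i, a i = -1 ∨ a i = -2)
    (hb : ∀ j, N.along hz (b j) = (a j * z⁻¹ : RatFunc K) • b j +
      ∑ i, (z ^ (a j - a i) * f i j) • b i) (n : ℕ) :
    N.InjModAt hz (Submodule.span (localRing x) (Set.range b)) 1 n := by
  classical
  have hz0 := hz.isParam.ne_zero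
  intro e he h1
  have he' := (mem_span_basis_iff b).1 he
  rw [mem_span_basis_iff] at h1 ⊢
  have hval : ∀ (v : V) (i : ι), val x (b.repr (z ^ (-1 : ℤ) • v) i) ≤ 1 ↔
      val x (b.repr v i) < 1 := by
    intro v i
    rw [map_smul, Finsupp.smul_apply, smul_eq_mul, ← exp_zero, hz.isParam.val_zpow_mul_le]
    exact le_exp_neg_one_iff
  simp_rw [hval] at h1 ⊢
  set y : ι → RatFunc K := fun i => b.repr e i with hy
  have hcoord : ∀ i, b.repr (N.shifted hz 1 n e) i =
      z * hz.deriv (y i) + ((a i - n : ℤ) : RatFunc K) * y i +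
        ∑ j, z ^ (1 + a j - a i) * f i j * y j := by
    intro i
    have hj : ∀ j, N.shifted hz 1 n (b j) =
        ((a j - n : ℤ) : RatFunc K) • b j + ∑ i, (z ^ (1 + a j - a i) * f i j) • b i := by
      intro j
      rw [N.shifted_apply, hb, smul_add, Finset.smul_sum, smul_smul]
      simp only [Nat.cast_one, zpow_one, sub_self, zpow_zero, mul_one, smul_smul]
      have e1 : z * (a j * z⁻¹) = a j := by field_simp
      have e2 : ∀ i, z * (z ^ (a j - a i) * f i j) = z ^ (1 + a j - a i) * f i j := fun i => by
        rw [← mul_assoc, add_sub_assoc, zpow_add₀ hz0, zpow_one]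
      simp only [e1, e2]
      push_cast
      rw [sub_smul]
      abel
    have he2 : N.shifted hz 1 n e = ∑ j, ((z * hz.deriv (y j)) • b j +
        y j • N.shifted hz 1 n (b j)) := by
      conv_lhs => rw [← b.sum_repr e]
      rw [map_sum]
      refine Finset.sum_congr rfl fun j _ => ?_
      rw [N.shifted_smul]
      simp [hy]
    rw [he2, map_sum, Finsupp.coe_finsetSum, Finset.sum_apply]
    simp only [hj, map_add, map_smul, map_sum, Finsupp.add_apply, Finsupp.smul_apply, smul_eq_mul,
      Finsupp.coe_finsetSum, Finset.sum_apply, b.repr_self, Finsupp.single_apply, mul_ite, mul_one,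
      mul_zero, Finset.sum_ite_eq', Finset.sum_add_distrib, mul_add, Finset.mem_univ, if_true]
    rw [← add_assoc, mul_comm (y i)]
    congr 1
    exact Finset.sum_congr rfl fun j _ => mul_comm _ _
  have step : ∀ i, (∀ j, val x (z ^ (1 + a j - a i) * f i j * y j) < 1) → val x (y i) < 1 := by
    intro i hi
    have h2 : val x (((a i - n : ℤ) : RatFunc K) * y i) < 1 := by
      have h3 : val x (∑ j, z ^ (1 + a j - a i) * f i j * y j) < 1 :=
        Valuation.map_sum_lt _ one_ne_zero fun j _ => hi j
      have h4 : val x (z * hz.deriv (y i)) < 1 := by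
        rw [map_mul]
        exact (mul_le_of_le_one_right' (hz.val_deriv_le (he' i))).trans_lt hz.isParam.val_lt_one
      have h5 := Valuation.map_sub_lt _ (Valuation.map_sub_lt _ (h1 i) h3) h4
      rw [hcoord] at h5
      convert h5 using 2
      ring
    rw [map_mul] at h2
    have h6 : val x (((a i - n : ℤ) : RatFunc K)) = 1 := by
      have := val_C x (c := ((a i - n : ℤ) : K)) (by
        rw [Int.cast_ne_zero]
        rcases ha i with h | h <;> omega)
      simpa using this
    rwa [h6, one_mul] at h2
  have hzf : ∀ (c : ℤ) i j, 0 ≤ c → val x (z ^ c * f i j * y j) ≤ val x (y j) := by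
    intro c i j hc
    rw [map_mul]
    refine mul_le_of_le_one_left' ?_
    rw [← exp_zero, hz.isParam.val_zpow_mul_le]
    refine (hf i j).trans ?_
    rw [← exp_zero, exp_le_exp]
    omega
  have hzf' : ∀ (c : ℤ) i j, 1 ≤ c → val x (z ^ c * f i j * y j) < 1 := by
    intro c i j hc
    rw [← le_exp_neg_one_iff, mul_assoc, hz.isParam.val_zpow_mul_le]
    refine (map_mul (val x) _ _).le.trans ((mul_le_one' (hf i j) (he' j)).trans ?_)
    rw [← exp_zero, exp_le_exp]
    omega
  have htwo : ∀ i, a i = -2 → val x (y i) < 1 := by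
    intro i hi
    refine step i fun j => hzf' _ _ _ ?_
    rcases ha j with h | h <;> omega
  intro i
  refine step i fun j => ?_
  rcases ha j with h | h
  · apply hzf'
    rcases ha i with h' | h' <;> omega
  · refine (hzf _ _ _ ?_).trans_lt (htwo j h)
    rcases ha i with h' | h' <;> omega

theorem exists_equiv_sum {n : ℕ} (P : Fin n → Prop) : ∃ (p q : ℕ) (e : Fin n ≃ Fin p ⊕ Fin q),
    (∀ i, P (e.symm (Sum.inl i))) ∧ ∀ i, ¬ P (e.symm (Sum.inr i)) := by
  classical
  refine ⟨_, _, (Equiv.sumCompl P).symm.trans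
    (Equiv.sumCongr (Fintype.equivFin _) (Fintype.equivFin _)), fun i => ?_, fun i => ?_⟩
  · exact ((Fintype.equivFin {i // P i}).symm i).2
  · exact ((Fintype.equivFin {i // ¬ P i}).symm i).2

variable {E L : VecBundle K V}

/-- The modification of a bundle at a point `x` at which the connection is regular. -/
theorem isSpecialPseudoLogAt_of_regular [CharZero k] (hE : HasPolesAt E N x 0) (hz : IsCoord x z)
    {b : Module.Basis (Fin (Module.finrank (RatFunc K) V)) (RatFunc K) V}
    (hb : E.stalk x = Submodule.span (localRing x) (Set.range b))
    {a : Fin (Module.finrank (RatFunc K) V) → ℤ} (ha : ∀ i, a i = -1 ∨ a i = -2)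
    (hL : L.stalk x = Submodule.span (localRing x)
      (Set.range (scale b (fun i => z ^ a i) fun _ => zpow_ne_zero _ hz.isParam.ne_zero))) :
    IsSpecialPseudoLogAt L N x ∧
      (∀ e ∈ L.stalk x, z ^ ((1 : ℕ) : ℤ) • N.along hz e ∈ L.stalk x) ∧
      ∀ n : ℕ, N.InjModAt hz (L.stalk x) 1 n := by
  have hz0 := hz.isParam.ne_zero
  have : CharZero K := charZero_of_injective_algebraMap (algebraMap k K).injective
  have hN : ∀ j, ∃ s : Fin (Module.finrank (RatFunc K) V) → Ω[RatFunc K⁄k],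
      (∀ i, s i ∈ regForms x k) ∧ N.toHom (b j) = ∑ i, s i ⊗ₜ[RatFunc K] b i := fun j => by
    have := hE (b j) (by rw [hb]; exact Submodule.subset_span ⟨j, rfl⟩)
    rw [hb] at this
    exact (mem_tens_span_iff b).1 this
  choose s hs hNs using hN
  choose f hf η hη hsf using fun j i => hz.exists_of_mem_regForms (hs j i)
  set c := scale b (fun i => z ^ a i) fun _ => zpow_ne_zero _ hz0 with hc
  have hA : HasMatrix N b (Matrix.of fun i j => s j i) := hNs
  have hM := hasMatrix_scale hz0 hA a
  rw [← hc] at hM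
  have hzval : ∀ (n : ℤ), 0 ≤ n → ∀ g, val x g ≤ 1 → val x (z ^ n * g) ≤ 1 := by
    intro n hn g hg
    rw [← exp_zero, hz.isParam.val_zpow_mul_le]
    refine hg.trans ?_
    rw [← exp_zero, exp_le_exp]
    omega
  -- The exponents differ by at most one, so the change of frame creates no worse than simple poles.
  have hexp : ∀ i j, 0 ≤ 1 + a j - a i := fun i j => by
    rcases ha i with h | h <;> rcases ha j with h' | h' <;> omega
  let g : Matrix (Fin (Module.finrank (RatFunc K) V)) (Fin (Module.finrank (RatFunc K) V))
    (RatFunc K) := (Matrix.of fun i j => z ^ (1 + a j - a i) * f j i) +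
      Matrix.diagonal fun i => (a i : RatFunc K)
  have hg : ∀ i j, val x (g i j) ≤ 1 := by
    intro i j
    refine Valuation.map_add_le _ (hzval _ (hexp i j) _ (hf j i)) ?_
    rw [Matrix.diagonal_apply]
    split_ifs
    · simpa using val_C_le x (a i : K)
    · simp
  have hM' : HasMatrix N c (Matrix.of fun i j =>
      (g i j * z⁻¹) • KaehlerDifferential.D k (RatFunc K) z +
        z⁻¹ • (z ^ (1 + a j - a i) • η j i)) := by
    convert hM using 1
    ext i j
    simp only [Matrix.of_apply, Matrix.add_apply, g, hsf, add_mul, add_smul, smul_add, smul_smul]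
    have e1 : z ^ (1 + a j - a i) * f j i * z⁻¹ = z ^ (a j - a i) * f j i := by
      rw [add_sub_assoc, zpow_add₀ hz0, zpow_one]
      field_simp
    have e2 : z⁻¹ * z ^ (1 + a j - a i) = z ^ (a j - a i) := by
      rw [add_sub_assoc, zpow_add₀ hz0, zpow_one, ← mul_assoc, inv_mul_cancel₀ hz0, one_mul]
    rw [e1, e2]
    by_cases hij : i = j
    · subst hij
      simp only [Matrix.diagonal_apply_eq]
      abel
    · simp only [Matrix.diagonal_apply_ne _ hij, zero_mul, zero_smul]
      abel
  have hηc : ∀ i j, z ^ (1 + a j - a i) • η j i ∈ constForms x k := fun i j =>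
    smul_mem_of_val_le (by simpa using hzval _ (hexp i j) 1 (by simp)) (hη j i)
  have halong : ∀ j, N.along hz (c j) = (a j * z⁻¹ : RatFunc K) • c j +
      ∑ i, (z ^ (a j - a i) * f j i) • c i := by
    intro j
    rw [HasMatrix.along_eq hz (fun i j => by
      rw [map_smul, map_constForms (hηc i j), smul_zero]) hM']
    simp only [g, Matrix.add_apply, Matrix.of_apply, add_mul, add_smul, Finset.sum_add_distrib]
    rw [add_comm]
    congr 1
    · rw [Finset.sum_eq_single j]
      · rw [Matrix.diagonal_apply_eq]
      · intro i _ hij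
        rw [Matrix.diagonal_apply_ne _ hij, zero_mul, zero_smul]
      · simp
    · refine Finset.sum_congr rfl fun i _ => ?_
      rw [add_sub_assoc, zpow_add₀ hz0, zpow_one]
      congr 1
      field_simp
  have hinj : ∀ n : ℕ, N.InjModAt hz (L.stalk x) 1 n := by
    rw [hL]
    exact injModAt_scale hz c (f := fun i j => f j i) (fun i j => hf j i) ha halong
  refine ⟨⟨isPseudoLogAt_of_injModAt hz hL hg hηc hM' (hinj 0), z, hz.isParam, ?_⟩, ?_, hinj⟩
  · obtain ⟨p, q, e, he₁, he₂⟩ := exists_equiv_sum fun i => a i = -2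
    have he₂' : ∀ i, a (e.symm (Sum.inr i)) = -1 := fun i => (ha _).resolve_right (he₂ i)
    set A : Matrix (Fin p ⊕ Fin q) (Fin p ⊕ Fin q) Ω[RatFunc K⁄k] :=
      Matrix.of fun i j => s (e.symm j) (e.symm i) with hAdef
    refine ⟨p, q, c.reindex e, by rw [hL, Module.Basis.range_reindex], A.toBlocks₁₁, A.toBlocks₁₂,
      A.toBlocks₂₁, A.toBlocks₂₂, -2, -1, fun i j => ?_, ?_⟩
    · rw [Matrix.fromBlocks_toBlocks]
      exact hs _ _
    · have hdiag : ∀ (m : ℤ) (w : Ω[RatFunc K⁄k]),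
          ((m : RatFunc K) * z⁻¹) • w = (m : k) • z⁻¹ • w := by
        intro m w
        rw [mul_smul, Int.cast_smul_eq_zsmul, Int.cast_smul_eq_zsmul]
      convert hM.reindex e using 1
      ext i j
      rcases i with i | i <;> rcases j with j | j <;>
        simp only [Matrix.fromBlocks_apply₁₁, Matrix.fromBlocks_apply₁₂,
          Matrix.fromBlocks_apply₂₁, Matrix.fromBlocks_apply₂₂, Matrix.submatrix_apply,
          Matrix.add_apply, Matrix.of_apply, Matrix.smul_apply, Matrix.toBlocks₁₁, Matrix.toBlocks₁₂,
          Matrix.toBlocks₂₁, Matrix.toBlocks₂₂, hAdef, Matrix.diagonal_apply, he₁, he₂', hdiag,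
          e.symm.injective.eq_iff, Sum.inl.injEq, Sum.inr.injEq, reduceCtorEq, if_false, add_zero]
      all_goals norm_num
  · rw [hL]
    refine fun e he => N.zpow_smul_along_mem_span hz c (fun j => ?_) he
    rw [HasMatrix.along_eq hz (fun i j => by
      rw [map_smul, map_constForms (hηc i j), smul_zero]) hM', Finset.smul_sum]
    refine Submodule.sum_mem _ fun i _ => ?_
    rw [smul_smul, Nat.cast_one, zpow_one, mul_left_comm, mul_inv_cancel₀ hz0, mul_one]
    exact smul_mem_of_val_le (hg i j) (Submodule.subset_span ⟨i, rfl⟩)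

end Modification

/-! ### Vector bundles on the projective line are sums of line bundles -/

section Splitting

variable {K : Type*} [Field K] {V : Type*} [AddCommGroup V] [Module (RatFunc K) V]

theorem VecBundle.top_le_span (E : VecBundle K V) {x : ClosedPoint K} {T : Set V}
    (hT : E.stalk x ≤ Submodule.span (localRing x) T) : ⊤ ≤ Submodule.span (RatFunc K) T := by
  obtain ⟨b, hb⟩ := E.locallyFree x
  rw [← b.span_eq, Submodule.span_le]
  rintro _ ⟨i, rfl⟩
  apply Submodule.span_subset_span (localRing x) (RatFunc K)
  apply hT
  rw [hb]
  exact Submodule.subset_span ⟨i, rfl⟩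

theorem VecBundle.exists_basis_of_stalk_le [FiniteDimensional (RatFunc K) V] (E : VecBundle K V)
    {x : ClosedPoint K} {m : Fin (Module.finrank (RatFunc K) V) → V}
    (hm : E.stalk x ≤ Submodule.span (localRing x) (Set.range m)) :
    ∃ b : Module.Basis (Fin (Module.finrank (RatFunc K) V)) (RatFunc K) V, ⇑b = m :=
  ⟨basisOfTopLeSpanOfCardEqFinrank m (E.top_le_span hm) (by simp), by simp⟩

theorem VecBundle.finrank_le_of_stalk_le (E : VecBundle K V) {x : ClosedPoint K} {n : ℕ}
    {m : Fin n → V} (hm : E.stalk x ≤ Submodule.span (localRing x) (Set.range m)) :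
    Module.finrank (RatFunc K) V ≤ n := by
  have := finrank_range_le_card (R := RatFunc K) m
  rw [Set.finrank, top_le_iff.1 (E.top_le_span hm), finrank_top] at this
  simpa using this

theorem exists_common_denominator {ι : Type*} [Finite ι] (g : ι → RatFunc K) :
    ∃ f : K[X], f ≠ 0 ∧ ∀ i, ∃ p : K[X],
      algebraMap K[X] (RatFunc K) f * g i = algebraMap K[X] (RatFunc K) p := by
  obtain ⟨f, hf⟩ := IsLocalization.exist_integer_multiples_of_finite (nonZeroDivisors K[X]) g
  refine ⟨f, nonZeroDivisors.ne_zero f.2, fun i => ?_⟩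
  obtain ⟨p, hp⟩ := hf i
  exact ⟨p, by rw [hp, Algebra.smul_def]⟩

/-- A polynomial that bounds the denominators of a bundle with respect to a basis. -/
theorem VecBundle.exists_denominator (E : VecBundle K V)
    (b : Module.Basis (Fin (Module.finrank (RatFunc K) V)) (RatFunc K) V)
    (hb : {x | E.stalk x ≠ Submodule.span (localRing x) (Set.range b)}.Finite) :
    ∃ f : K[X], f ≠ 0 ∧ ∀ v, ∀ e ∈ E.stalk (some v), ∀ i,
      val (some v) (algebraMap K[X] (RatFunc K) f * b.repr e i) ≤ 1 := by
  classical
  have hloc : ∀ v, ∃ f : K[X], f ≠ 0 ∧ ∀ e ∈ E.stalk (some v), ∀ i,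
      val (some v) (algebraMap K[X] (RatFunc K) f * b.repr e i) ≤ 1 := by
    intro v
    obtain ⟨c, hc⟩ := E.locallyFree (some v)
    obtain ⟨f, hf, h⟩ := exists_common_denominator fun ij : Fin _ × Fin _ => b.repr (c ij.1) ij.2
    refine ⟨f, hf, fun e he i => ?_⟩
    rw [hc, mem_span_basis_iff] at he
    rw [← c.sum_repr e]
    simp only [map_sum, map_smul, Finsupp.coe_finsetSum, Finset.sum_apply, Finsupp.smul_apply,
      smul_eq_mul, Finset.mul_sum]
    refine Valuation.map_sum_le _ fun j _ => ?_
    obtain ⟨p, hp⟩ := h (j, i)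
    rw [mul_left_comm, hp, map_mul]
    exact mul_le_one' (he j) (val_algebraMap_le v p)
  choose f hf h using hloc
  have hfin : {v | E.stalk (some v) ≠ Submodule.span (localRing (some v)) (Set.range b)}.Finite :=
    hb.preimage (Option.some_injective _).injOn
  refine ⟨∏ v ∈ hfin.toFinset, f v, Finset.prod_ne_zero_iff.2 fun v _ => hf v, fun v e he i => ?_⟩
  by_cases hv : E.stalk (some v) = Submodule.span (localRing (some v)) (Set.range b)
  · rw [hv, mem_span_basis_iff] at he
    rw [map_mul]
    exact mul_le_one' (val_algebraMap_le v _) (he i)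
  · rw [← Finset.mul_prod_erase _ f (hfin.mem_toFinset.2 hv),
      map_mul (algebraMap K[X] (RatFunc K)), mul_right_comm, map_mul]
    exact mul_le_one' (h v e he i) (val_algebraMap_le v _)

/-- An element of a stalk becomes a section over the affine line after multiplication by a function
that is invertible at the given point. -/
theorem VecBundle.exists_smul_mem (E : VecBundle K V)
    (v : IsDedekindDomain.HeightOneSpectrum K[X]) {e : V} (he : e ∈ E.stalk (some v)) :
    ∃ g : K[X], g ∉ v.asIdeal ∧
      ∀ w, algebraMap K[X] (RatFunc K) g • e ∈ E.stalk (some w) := by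
  classical
  have hloc : ∀ w, ∃ g : K[X], g ∉ v.asIdeal ∧
      algebraMap K[X] (RatFunc K) g • e ∈ E.stalk (some w) := by
    intro w
    rcases eq_or_ne w v with rfl | hwv
    · exact ⟨1, (Ideal.ne_top_iff_one _).1 w.isPrime.ne_top, by simpa using he⟩
    · obtain ⟨p, hpw, hpv⟩ : ∃ p ∈ w.asIdeal, p ∉ v.asIdeal := by
        by_contra! h
        exact hwv (IsDedekindDomain.HeightOneSpectrum.ext
          (w.isMaximal.eq_of_le v.isPrime.ne_top h))
      obtain ⟨c, hc⟩ := E.locallyFree (some w)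
      have hp : val (some w) (algebraMap K[X] (RatFunc K) p) ≤ exp (-1) :=
        le_exp_neg_one_iff.2 (val_algebraMap_lt_one.2 hpw)
      choose n hn using fun i => exists_nat_le_exp (val (some w) (c.repr e i))
      -- `p` vanishes at `w` but not at `v`, and the power is large enough to cancel every pole of
      -- `e` at `w`.
      refine ⟨p ^ ∑ i, n i, fun h => hpv (v.isPrime.mem_of_pow_mem _ h), ?_⟩
      rw [hc, mem_span_basis_iff]
      intro i
      rw [map_smul, Finsupp.smul_apply, smul_eq_mul, map_mul, map_pow, map_pow]
      calc _ ≤ exp (-1 : ℤ) ^ (∑ i, n i) * exp ((∑ i, n i : ℕ) : ℤ) := by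
            refine mul_le_mul' (pow_le_pow_left' hp _) ((hn i).trans ?_)
            rw [exp_le_exp]
            exact_mod_cast Finset.single_le_sum (f := n) (fun _ _ => Nat.zero_le _)
              (Finset.mem_univ i)
        _ ≤ 1 := by
            rw [← exp_nsmul, ← exp_add, ← exp_zero, exp_le_exp]
            simp
  choose g hg h using hloc
  have hfin : {w | e ∉ E.stalk (some w)}.Finite :=
    (E.finite_notMem e).preimage (Option.some_injective _).injOn
  refine ⟨∏ w ∈ hfin.toFinset, g w, ?_, fun w => ?_⟩
  · intro hmem
    obtain ⟨w, -, hw⟩ := (Ideal.IsPrime.prod_mem_iff (hp := v.isPrime)).1 hmem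
    exact hg w hw
  · by_cases hw : e ∈ E.stalk (some w)
    · exact smul_mem_of_val_le (val_algebraMap_le w _) hw
    · rw [← Finset.prod_erase_mul _ g (hfin.mem_toFinset.2 hw), map_mul, mul_smul]
      exact smul_mem_of_val_le (val_algebraMap_le w _) (h w)

/-- A vector bundle on the affine line is trivial. -/
theorem VecBundle.exists_affine_frame [FiniteDimensional (RatFunc K) V] (E : VecBundle K V) :
    ∃ b : Module.Basis (Fin (Module.finrank (RatFunc K) V)) (RatFunc K) V,
      ∀ v, E.stalk (some v) = Submodule.span (localRing (some v)) (Set.range b) := by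
  classical
  obtain ⟨b, hb⟩ := E.coherent
  obtain ⟨f, hf, hfE⟩ := E.exists_denominator b hb
  have hf0 : algebraMap K[X] (RatFunc K) f ≠ 0 := by simpa using hf
  let τ : (Fin (Module.finrank (RatFunc K) V) → K[X]) → V := fun c =>
    ∑ i, (algebraMap K[X] (RatFunc K) (c i) / algebraMap K[X] (RatFunc K) f) • b i
  have hadd : ∀ c d, τ (c + d) = τ c + τ d := fun c d => by
    simp [τ, add_div, add_smul, Finset.sum_add_distrib]
  have hsmul : ∀ (p : K[X]) c, τ (p • c) = algebraMap K[X] (RatFunc K) p • τ c := fun p c => by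
    simp [τ, Finset.smul_sum, smul_smul, mul_div_assoc]
  -- The sections over the affine line, embedded in `K[t]^r` by means of the common denominator `f`.
  -- They form a free module because `K[t]` is a principal ideal domain.
  let M : Submodule K[X] (Fin (Module.finrank (RatFunc K) V) → K[X]) :=
    { carrier := {c | ∀ v, τ c ∈ E.stalk (some v)}
      zero_mem' := fun v => by simp [τ]
      add_mem' := fun {c d} hc hd v => by rw [hadd]; exact Submodule.add_mem _ (hc v) (hd v)
      smul_mem' := fun p c hc v => by
        rw [hsmul]; exact smul_mem_of_val_le (val_algebraMap_le v p) (hc v) }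
  obtain ⟨n, B⟩ := Submodule.basisOfPid (Pi.basisFun K[X] (Fin (Module.finrank (RatFunc K) V))) M
  have hτsum : ∀ p : Fin n → K[X], τ (∑ j, p j • B j : M).1 =
      ∑ j, algebraMap K[X] (RatFunc K) (p j) • τ (B j) := by
    intro p
    have h : ∀ s : Finset (Fin n), τ (∑ j ∈ s, p j • B j : M).1 =
        ∑ j ∈ s, algebraMap K[X] (RatFunc K) (p j) • τ (B j) := by
      intro s
      induction s using Finset.induction_on with
      | empty => simp [τ]
      | insert a s ha ih =>
        rw [Finset.sum_insert ha, Finset.sum_insert ha, Submodule.coe_add, hadd, ih,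
          Submodule.coe_smul, hsmul]
    exact h Finset.univ
  have hspan : ∀ v, E.stalk (some v) =
      Submodule.span (localRing (some v)) (Set.range fun j => τ (B j)) := by
    intro v
    apply le_antisymm
    · intro e he
      -- Sections over the affine line generate each stalk: `e` is such a section divided by a
      -- function invertible at `v`.
      obtain ⟨g, hg, hge⟩ := E.exists_smul_mem v he
      have hg1 := val_algebraMap_eq_one.2 hg
      have hg0 : algebraMap K[X] (RatFunc K) g ≠ 0 := fun h => by simp [h] at hg1
      choose c hc using fun i => exists_polynomial_of_val_le_one fun w => hfE w _ (hge w) i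
      have hτc : τ c = algebraMap K[X] (RatFunc K) g • e := by
        simp only [τ, hc, mul_div_cancel_left₀ _ hf0]
        exact b.sum_repr _
      have hcM : c ∈ M := fun w => by rw [hτc]; exact hge w
      have h1 := hτsum fun j => B.repr ⟨c, hcM⟩ j
      rw [B.sum_repr, hτc] at h1
      have h2 : e = (algebraMap K[X] (RatFunc K) g)⁻¹ • algebraMap K[X] (RatFunc K) g • e := by
        rw [smul_smul, inv_mul_cancel₀ hg0, one_smul]
      rw [h2, h1]
      refine smul_mem_of_val_le (by rw [map_inv₀, hg1, inv_one]) (Submodule.sum_mem _ fun j _ =>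
        smul_mem_of_val_le (val_algebraMap_le v _) (Submodule.subset_span ⟨j, rfl⟩))
    · rw [Submodule.span_le]
      rintro _ ⟨j, rfl⟩
      exact (B j).2 v
  have hn : n = Module.finrank (RatFunc K) V := by
    apply le_antisymm
    · have h := (B.linearIndependent.map' M.subtype M.ker_subtype).fintype_card_le_finrank
      simpa using h
    · exact E.finrank_le_of_stalk_le (hspan (pt 0)).le
  have hrange : Set.range (fun i => τ (B ((finCongr hn).symm i))) = Set.range fun j => τ (B j) :=
    EquivLike.range_comp (fun j => τ (B j)) (finCongr hn).symm
  obtain ⟨b', hb'⟩ := E.exists_basis_of_stalk_le (x := some (pt 0))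
    (m := fun i => τ (B ((finCongr hn).symm i))) (by rw [hrange]; exact (hspan _).le)
  exact ⟨b', fun v => by rw [hb', hrange, hspan]⟩

/-- A frame over the affine line, in which every vector of degree `dᵢ` is regular at infinity up to
a factor `t^{dᵢ}`. -/
structure VecBundle.IsAdapted (E : VecBundle K V)
    (b : Module.Basis (Fin (Module.finrank (RatFunc K) V)) (RatFunc K) V)
    (d : Fin (Module.finrank (RatFunc K) V) → ℤ) : Prop where
  stalk_eq : ∀ v, E.stalk (some v) = Submodule.span (localRing (some v)) (Set.range b)
  mem_infty : ∀ i, (RatFunc.X : RatFunc K) ^ (-d i) • b i ∈ E.stalk none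

/-- A nonzero section over the affine line has a nonzero polynomial coordinate, of degree at least
zero, while regularity at infinity bounds that degree by `d` plus a constant. This makes the
lowering of degrees terminate. -/
theorem VecBundle.exists_degree_bound [FiniteDimensional (RatFunc K) V] (E : VecBundle K V) :
    ∃ N : ℤ, (∀ e ≠ 0, (∀ v, e ∈ E.stalk (some v)) → ∀ d : ℤ,
      (RatFunc.X : RatFunc K) ^ (-d) • e ∈ E.stalk none → -N ≤ d) := by
  obtain ⟨b, hb⟩ := E.exists_affine_frame
  obtain ⟨c, hc⟩ := E.locallyFree none
  choose n hn using fun ij : Fin (Module.finrank (RatFunc K) V) ×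
    Fin (Module.finrank (RatFunc K) V) => exists_nat_le_exp (val none (b.repr (c ij.1) ij.2))
  refine ⟨((∑ ij, n ij : ℕ) : ℤ), fun e he heE d hd => ?_⟩
  have hcoord : ∀ e ∈ E.stalk none, ∀ i, val none (b.repr e i) ≤ exp ((∑ ij, n ij : ℕ) : ℤ) := by
    intro e he i
    rw [hc, mem_span_basis_iff] at he
    rw [← c.sum_repr e]
    simp only [map_sum, map_smul, Finsupp.coe_finsetSum, Finset.sum_apply, Finsupp.smul_apply,
      smul_eq_mul]
    refine Valuation.map_sum_le _ fun j _ => ?_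
    rw [map_mul]
    refine (mul_le_of_le_one_left' (he j)).trans ((hn (j, i)).trans ?_)
    rw [exp_le_exp]
    exact_mod_cast Finset.single_le_sum (f := n) (fun _ _ => Nat.zero_le _)
      (Finset.mem_univ (j, i))
  obtain ⟨i, hi⟩ : ∃ i, b.repr e i ≠ 0 := by
    by_contra! h
    exact he (b.repr.map_eq_zero_iff.1 (Finsupp.ext h))
  obtain ⟨p, hp⟩ := exists_polynomial_of_val_le_one (f := b.repr e i) fun v =>
    (mem_span_basis_iff b).1 (hb v ▸ heE v) i
  have hp0 : p ≠ 0 := by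
    rintro rfl
    exact hi (by simpa using hp.symm)
  have h1 := hcoord _ hd i
  rw [map_smul, Finsupp.smul_apply, smul_eq_mul, map_mul, map_zpow₀, val_none_X, ← hp,
    val_none_algebraMap hp0, ← exp_zsmul, ← exp_add, exp_le_exp] at h1
  simp only [smul_eq_mul, mul_one] at h1
  omega

/-- If the leading terms at infinity of an adapted frame are dependent, then the degree of one of
its vectors can be lowered. -/
theorem VecBundle.IsAdapted.exists_lower [FiniteDimensional (RatFunc K) V] {E : VecBundle K V}
    {b : Module.Basis (Fin (Module.finrank (RatFunc K) V)) (RatFunc K) V}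
    {d : Fin (Module.finrank (RatFunc K) V) → ℤ} (h : E.IsAdapted b d)
    {u : Fin (Module.finrank (RatFunc K) V) → K} (hu : u ≠ 0)
    (hdep : (RatFunc.X : RatFunc K) •
      ∑ j, RatFunc.C (u j) • (RatFunc.X : RatFunc K) ^ (-d j) • b j ∈ E.stalk none) :
    ∃ b' d', E.IsAdapted b' d' ∧ ∑ i, d' i = ∑ i, d i - 1 := by
  classical
  have hX := RatFunc.X_ne_zero (K := K)
  -- Maximality of `d i₀` makes the factors `t^(d i₀ - d j)` polynomials. Since the coefficient of
  -- `b i₀` is a nonzero constant, exchanging this vector for the combination keeps a frame over the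
  -- affine line.
  obtain ⟨i₀, hi₀, hmax⟩ : ∃ i₀, u i₀ ≠ 0 ∧ ∀ j, u j ≠ 0 → d j ≤ d i₀ := by
    obtain ⟨i, hi⟩ := Function.ne_iff.1 hu
    obtain ⟨i₀, hi₀, hmax⟩ := Finset.exists_max_image (Finset.univ.filter fun j => u j ≠ 0) d
      ⟨i, by simpa using hi⟩
    exact ⟨i₀, by simpa using hi₀, fun j hj => hmax j (by simpa using hj)⟩
  let y : Fin (Module.finrank (RatFunc K) V) → RatFunc K := fun j =>
    RatFunc.C (u j) * RatFunc.X ^ (d i₀ - d j)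
  have hy : ∀ v j, val (some v) (y j) ≤ 1 := by
    intro v j
    by_cases hj : u j = 0
    · simp [y, hj]
    · have h1 := hmax j hj
      obtain ⟨n, hn⟩ := Int.eq_ofNat_of_zero_le (sub_nonneg.2 h1)
      rw [map_mul, hn, zpow_natCast, map_pow, ← RatFunc.algebraMap_X]
      exact mul_le_one' (val_C_le _ _) (pow_le_one' (val_algebraMap_le v _) n)
  have hy₀ : y i₀ = RatFunc.C (u i₀) := by simp [y]
  let m := Function.update b i₀ (∑ j, y j • b j)
  have hmspan : ∀ v, E.stalk (some v) = Submodule.span (localRing (some v)) (Set.range m) := by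
    intro v
    rw [h.stalk_eq]
    apply le_antisymm
    · rw [Submodule.span_le]
      rintro _ ⟨i, rfl⟩
      have hne : ∀ i ≠ i₀, b i ∈ Submodule.span (localRing (some v)) (Set.range m) :=
        fun i hi => Submodule.subset_span ⟨i, by simp [m, hi]⟩
      rcases eq_or_ne i i₀ with rfl | hi
      · have e1 : b i = (y i)⁻¹ • (m i - ∑ j ∈ Finset.univ.erase i, y j • b j) := by
          have hyi : y i ≠ 0 := by rw [hy₀]; simpa using hi₀
          simp only [m, Function.update_self]
          rw [← Finset.add_sum_erase _ _ (Finset.mem_univ i), add_sub_cancel_right, smul_smul,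
            inv_mul_cancel₀ hyi, one_smul]
        rw [SetLike.mem_coe, e1]
        refine smul_mem_of_val_le ?_ (Submodule.sub_mem _ (Submodule.subset_span ⟨i, rfl⟩)
          (Submodule.sum_mem _ fun j hj => smul_mem_of_val_le (hy v j)
            (hne j (Finset.ne_of_mem_erase hj))))
        rw [hy₀, map_inv₀, val_C _ hi₀, inv_one]
      · exact hne i hi
    · rw [Submodule.span_le]
      rintro _ ⟨i, rfl⟩
      rcases eq_or_ne i i₀ with rfl | hi
      · simp only [m, Function.update_self]
        exact Submodule.sum_mem _ fun j _ =>
          smul_mem_of_val_le (hy v j) (Submodule.subset_span ⟨j, rfl⟩)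
      · simp only [m, Function.update_of_ne hi]
        exact Submodule.subset_span ⟨i, rfl⟩
  obtain ⟨b', hb'⟩ := E.exists_basis_of_stalk_le (hmspan (pt 0)).le
  refine ⟨b', Function.update d i₀ (d i₀ - 1), ⟨fun v => by rw [hb', hmspan], fun i => ?_⟩, ?_⟩
  · rw [hb']
    rcases eq_or_ne i i₀ with rfl | hi
    · simp only [m, Function.update_self]
      convert hdep using 1
      rw [Finset.smul_sum, Finset.smul_sum]
      refine Finset.sum_congr rfl fun j _ => ?_
      simp only [y, smul_smul]
      congr 1
      rw [mul_left_comm, mul_left_comm RatFunc.X, ← zpow_add₀ hX, ← zpow_one_add₀ hX]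
      congr 2
      ring
    · simp only [m, Function.update_of_ne hi]
      exact h.mem_infty i
  · rw [Finset.sum_update_of_mem (Finset.mem_univ i₀), ← Finset.add_sum_erase _ d (Finset.mem_univ i₀),
      Finset.erase_eq]
    ring

/-- `g` expresses the vectors `t^(-dⱼ) bⱼ` in a frame at infinity. If its determinant is a unit they
form a frame themselves; otherwise a constant kernel vector modulo `𝔪` is a dependence between
leading terms. -/
theorem VecBundle.IsAdapted.eq_or_exists [FiniteDimensional (RatFunc K) V] {E : VecBundle K V}
    {b : Module.Basis (Fin (Module.finrank (RatFunc K) V)) (RatFunc K) V}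
    {d : Fin (Module.finrank (RatFunc K) V) → ℤ} (h : E.IsAdapted b d) :
    E.stalk none = Submodule.span (localRing none) (Set.range (scale b
      (fun i => (RatFunc.X : RatFunc K) ^ (-d i)) fun _ => zpow_ne_zero _ RatFunc.X_ne_zero)) ∨
    ∃ b' d', E.IsAdapted b' d' ∧ ∑ i, d' i = ∑ i, d i - 1 := by
  set s := scale b (fun i => (RatFunc.X : RatFunc K) ^ (-d i))
    fun _ => zpow_ne_zero _ RatFunc.X_ne_zero with hs
  obtain ⟨c, hc⟩ := E.locallyFree none
  have hmem : ∀ j, s j ∈ E.stalk none := fun j => by rw [hs, scale_apply]; exact h.mem_infty j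
  have hmem' := hmem
  rw [hc] at hmem'
  let g : Matrix (Fin (Module.finrank (RatFunc K) V)) (Fin (Module.finrank (RatFunc K) V))
    (localRing (none : ClosedPoint K)) :=
    fun i j => ⟨c.repr (s j) i, (mem_span_basis_iff c).1 (hmem' j) i⟩
  by_cases hg : IsUnit g.det
  · left
    apply le_antisymm
    · intro e he
      rw [hc, mem_span_basis_iff] at he
      let y : Fin (Module.finrank (RatFunc K) V) → localRing (none : ClosedPoint K) :=
        fun i => ⟨c.repr e i, he i⟩
      let f := g⁻¹.mulVec y
      have hf : g.mulVec f = y := by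
        rw [Matrix.mulVec_mulVec, Matrix.mul_nonsing_inv _ hg, Matrix.one_mulVec]
      have e1 : e = ∑ j, (f j : RatFunc K) • s j := by
        apply c.repr.injective
        ext i
        have := congrArg Subtype.val (congrFun hf i)
        simp only [Matrix.mulVec, dotProduct] at this
        push_cast at this
        rw [← show (y i : RatFunc K) = c.repr e i from rfl, ← this]
        simp only [map_sum, map_smul, Finsupp.coe_finsetSum, Finset.sum_apply, Finsupp.smul_apply,
          smul_eq_mul]
        exact Finset.sum_congr rfl fun j _ => mul_comm _ _
      rw [e1]
      exact Submodule.sum_mem _ fun j _ =>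
        smul_mem_of_val_le (f j).2 (Submodule.subset_span ⟨j, rfl⟩)
    · rw [Submodule.span_le]
      rintro _ ⟨j, rfl⟩
      exact hmem j
  · right
    obtain ⟨u, hu, hlt⟩ := exists_const_of_not_isUnit_det isCoord_infty.isRational hg
    refine h.exists_lower hu ?_
    rw [hc, mem_span_basis_iff]
    intro i
    have e1 : c.repr (∑ j, RatFunc.C (u j) • (RatFunc.X : RatFunc K) ^ (-d j) • b j) i =
        ∑ j, (g i j : RatFunc K) * RatFunc.C (u j) := by
      simp only [map_sum, Finsupp.coe_finsetSum, Finset.sum_apply]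
      refine Finset.sum_congr rfl fun j _ => ?_
      rw [map_smul, Finsupp.smul_apply, smul_eq_mul, mul_comm]
      simp only [g, hs, scale_apply]
    rw [map_smul, Finsupp.smul_apply, e1, smul_eq_mul, map_mul, val_none_X]
    have := le_exp_neg_one_iff.2 (hlt i)
    calc _ ≤ exp (1 : ℤ) * exp (-1) := mul_le_mul_right this _
      _ = 1 := by rw [← exp_add]; simp

/-- The theorem of Birkhoff and Grothendieck. -/
theorem VecBundle.exists_splitting [FiniteDimensional (RatFunc K) V] (E : VecBundle K V) :
    ∃ (b : Module.Basis (Fin (Module.finrank (RatFunc K) V)) (RatFunc K) V)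
      (d : Fin (Module.finrank (RatFunc K) V) → ℤ),
      (∀ v, E.stalk (some v) = Submodule.span (localRing (some v)) (Set.range b)) ∧
      E.stalk none = Submodule.span (localRing none) (Set.range (scale b
        (fun i => (RatFunc.X : RatFunc K) ^ d i) fun _ => zpow_ne_zero _ RatFunc.X_ne_zero)) := by
  obtain ⟨N, hN⟩ := E.exists_degree_bound
  have hnonneg : ∀ b d, E.IsAdapted b d → ∀ i, 0 ≤ d i + N := by
    intro b d h i
    have := hN (b i) (b.ne_zero i)
      (fun v => by rw [h.stalk_eq]; exact Submodule.subset_span ⟨i, rfl⟩) (d i) (h.mem_infty i)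
    omega
  -- Each lowering decreases `∑ (dᵢ + N)` by one, and this sum is never negative.
  have key : ∀ n : ℕ, ∀ b d, E.IsAdapted b d → ∑ i, (d i + N) ≤ n →
      ∃ b d, E.IsAdapted b d ∧ E.stalk none = Submodule.span (localRing none) (Set.range (scale b
        (fun i => (RatFunc.X : RatFunc K) ^ (-d i)) fun _ => zpow_ne_zero _ RatFunc.X_ne_zero)) := by
    intro n
    induction n with
    | zero =>
      intro b d h hd
      rcases h.eq_or_exists with h1 | ⟨b', d', h', hsum⟩
      · exact ⟨b, d, h, h1⟩
      · have := Finset.sum_nonneg fun i (_ : i ∈ Finset.univ) => hnonneg b' d' h' i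
        rw [Finset.sum_add_distrib] at this hd
        push_cast at hd
        omega
    | succ n ih =>
      intro b d h hd
      rcases h.eq_or_exists with h1 | ⟨b', d', h', hsum⟩
      · exact ⟨b, d, h, h1⟩
      · refine ih b' d' h' ?_
        rw [Finset.sum_add_distrib] at hd ⊢
        push_cast at hd
        omega
  obtain ⟨b, hb⟩ := E.exists_affine_frame
  obtain ⟨c, hc⟩ := E.locallyFree none
  have hd : ∀ e : V, ∃ d : ℤ, (RatFunc.X : RatFunc K) ^ (-d) • e ∈ E.stalk none := by
    intro e
    obtain ⟨n, hn⟩ := exists_nat_zpow_smul_mem isCoord_infty.isParam c e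
    refine ⟨n, ?_⟩
    rw [hc]
    convert hn using 2
    rw [inv_zpow', zpow_neg]
  choose d hd using fun i => hd (b i)
  obtain ⟨b', d', h, h'⟩ := key (∑ i, (d i + N)).toNat b d ⟨hb, hd⟩ (Int.self_le_toNat _)
  exact ⟨b', fun i => -d' i, h.stalk_eq, h'⟩

end Splitting

/-! ### Functions with prescribed divisors -/

section Functions

variable {K : Type*} [Field K]

theorem val_none_sub_C (a : K) : val (none : ClosedPoint K)
    (algebraMap K[X] (RatFunc K) (X - Polynomial.C a)) = exp 1 := by
  rw [val_none_algebraMap (X_sub_C_ne_zero a), natDegree_X_sub_C, Nat.cast_one]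

theorem algebraMap_sub_C_ne_zero (a : K) :
    algebraMap K[X] (RatFunc K) (X - Polynomial.C a) ≠ 0 := by
  rw [Ne, FaithfulSMul.algebraMap_eq_zero_iff]
  exact X_sub_C_ne_zero a

/-- The function `∏_{j < J} (t - q_j)^{e_j}` with `e_j = -2` for `j < n` and `e_j = -1` otherwise. -/
def poleFun (q : ℕ → K) (J n : ℕ) : RatFunc K :=
  ∏ j ∈ Finset.range J,
    algebraMap K[X] (RatFunc K) (X - Polynomial.C (q j)) ^ (if j < n then -2 else -1 : ℤ)

theorem poleFun_ne_zero (q : ℕ → K) (J n : ℕ) : poleFun q J n ≠ 0 :=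
  Finset.prod_ne_zero_iff.2 fun _ _ => zpow_ne_zero _ (algebraMap_sub_C_ne_zero _)

theorem val_none_poleFun (q : ℕ → K) {J n : ℕ} (hn : n ≤ J) :
    val (none : ClosedPoint K) (poleFun q J n) = exp (-(J + n : ℤ)) := by
  have h : ∀ J : ℕ, val (none : ClosedPoint K) (poleFun q J n) = exp (-(J + min J n : ℤ)) := by
    intro J
    induction J with
    | zero => simp [poleFun]
    | succ J ih =>
      rw [poleFun, Finset.prod_range_succ, map_mul, ← poleFun, ih, map_zpow₀, val_none_sub_C,
        ← exp_zsmul, ← exp_add, exp_inj, smul_eq_mul]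
      split_ifs <;> push_cast <;> omega
  rw [h, min_eq_right (by exact_mod_cast hn)]

theorem val_poleFun_of_ne (q : ℕ → K) (J n : ℕ) {v : IsDedekindDomain.HeightOneSpectrum K[X]}
    (hv : ∀ j < J, v ≠ pt (q j)) : val (some v) (poleFun q J n) = 1 := by
  rw [poleFun, map_prod]
  refine Finset.prod_eq_one fun j hj => ?_
  rw [map_zpow₀, val_sub_C_eq_one (hv j (Finset.mem_range.1 hj)), one_zpow]

theorem val_poleFun_pt {q : ℕ → K} (hq : Function.Injective q) (J n : ℕ) {i : ℕ} (hi : i < J) :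
    val (some (pt (q i))) (poleFun q J n) = exp 1 ∨ val (some (pt (q i))) (poleFun q J n) = exp 2 := by
  rw [poleFun, map_prod, Finset.prod_eq_single i]
  · rw [(isParam_pt (q i)).val_zpow]
    split_ifs <;> simp
  · intro j _ hj
    rw [map_zpow₀, val_sub_C_eq_one fun h => hj (hq (pt_injective h)).symm, one_zpow]
  · intro h
    exact absurd (Finset.mem_range.2 hi) h

/-- The local equation at `x` of the divisor `-d ∞`. -/
def inftyEquation (d : ℤ) : ClosedPoint K → RatFunc K
  | some _ => 1
  | none => RatFunc.X ^ d

/-- Rational functions that turn a sum of the line bundles `𝒪(dᵢ)` into a trivial bundle, up to a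
common twist at `x₁`, and have poles of order one or two at some additional rational points. -/
theorem exists_balancing [Infinite K] {r : ℕ} (d : Fin r → ℤ) (𝒟 : EffDivisor K) {x₁ : ClosedPoint K}
    (hx₁ : IsRational x₁) (h𝒟 : 𝒟 x₁ ≠ 0) :
    ∃ (P : Finset (ClosedPoint K)) (h : Fin r → RatFunc K) (c : ℤ),
      (∀ i, h i ≠ 0) ∧
      (∀ p ∈ P, 𝒟 p = 0 ∧ (∃ a, p = some (pt a)) ∧
        ∀ i, val p (h i) = exp 1 ∨ val p (h i) = exp 2) ∧
      (∀ x ∉ P, x ≠ x₁ → ∀ i, val x (h i) = val x (inftyEquation (d i) x)) ∧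
      ∀ i, val x₁ (h i) = exp c * val x₁ (inftyEquation (d i) x₁) := by
  classical
  -- As `K` is infinite, rational points outside the divisor never run out.
  have hinf : {a : K | 𝒟 (some (pt a)) = 0}.Infinite := by
    have hfin : {a : K | 𝒟 (some (pt a)) ≠ 0}.Finite := by
      refine (𝒟.support.finite_toSet.preimage
        ((Option.some_injective _).comp pt_injective).injOn).subset fun a ha => ?_
      simpa using ha
    have := hfin.infinite_compl
    convert this using 1
    ext a
    simp
  let q : ℕ → K := fun j => (hinf.natEmbedding _ j : K)
  have hq : Function.Injective q := Subtype.val_injective.comp (hinf.natEmbedding _).injective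
  have hq𝒟 : ∀ j, 𝒟 (some (pt (q j))) = 0 := fun j => (hinf.natEmbedding _ j).2
  obtain ⟨C, hC⟩ : ∃ C : ℤ, ∀ i, d i ≤ C :=
    ⟨∑ i, |d i|, fun i => (le_abs_self _).trans
      (Finset.single_le_sum (f := fun i => |d i|) (fun _ _ => abs_nonneg _) (Finset.mem_univ i))⟩
  -- The smaller `dᵢ` is, the more double poles are used: `dᵢ + nᵢ = C` for all `i`. With `J ≥ nᵢ`
  -- points, each of them carrying at least a simple pole, the excess `J + C` is independent of `i`.
  let n : Fin r → ℕ := fun i => (C - d i).toNat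
  have hn : ∀ i, (n i : ℤ) = C - d i := fun i => Int.toNat_of_nonneg (sub_nonneg.2 (hC i))
  let J := ∑ i, n i
  have hJ : ∀ i, n i ≤ J := fun i =>
    Finset.single_le_sum (f := n) (fun _ _ => Nat.zero_le _) (Finset.mem_univ i)
  let P : Finset (ClosedPoint K) := (Finset.range J).image fun j => some (pt (q j))
  have hPmem : ∀ {j}, j < J → some (pt (q j)) ∈ P := fun hj =>
    Finset.mem_image_of_mem _ (Finset.mem_range.2 hj)
  have hnotP : ∀ {v}, some v ∉ P → ∀ i, val (some v) (poleFun q J (n i)) = 1 := by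
    intro v hv i
    refine val_poleFun_of_ne q J (n i) fun j hj h => hv ?_
    rw [h]
    exact hPmem hj
  have hx₁P : x₁ ∉ P := by
    intro h
    obtain ⟨j, -, rfl⟩ := Finset.mem_image.1 h
    exact h𝒟 (hq𝒟 j)
  cases x₁ with
  | none =>
    refine ⟨P, fun i => poleFun q J (n i), -(J + C), fun i => poleFun_ne_zero _ _ _, ?_, ?_, ?_⟩
    · intro p hp
      obtain ⟨j, hj, rfl⟩ := Finset.mem_image.1 hp
      exact ⟨hq𝒟 j, ⟨q j, rfl⟩, fun i => val_poleFun_pt hq J (n i) (Finset.mem_range.1 hj)⟩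
    · rintro (_ | v) hx hx' i
      · exact absurd rfl hx'
      · rw [hnotP hx, inftyEquation, map_one]
    · intro i
      rw [val_none_poleFun q (hJ i), inftyEquation, map_zpow₀, val_none_X, ← exp_zsmul, ← exp_add,
        exp_inj, hn, smul_eq_mul]
      ring
  | some v =>
    obtain ⟨a, rfl⟩ := hx₁.eq_pt
    -- The factor `(t - a)^(J + C)` moves the common excess from infinity to `x₁`.
    refine ⟨P, fun i => algebraMap K[X] (RatFunc K) (X - Polynomial.C a) ^ ((J : ℤ) + C) *
      poleFun q J (n i), -(J + C), fun i =>
        mul_ne_zero (zpow_ne_zero _ (algebraMap_sub_C_ne_zero a)) (poleFun_ne_zero _ _ _), ?_, ?_, ?_⟩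
    · intro p hp
      obtain ⟨j, hj, rfl⟩ := Finset.mem_image.1 hp
      refine ⟨hq𝒟 j, ⟨q j, rfl⟩, fun i => ?_⟩
      rw [map_mul, map_zpow₀, val_sub_C_eq_one, one_zpow, one_mul]
      · exact val_poleFun_pt hq J (n i) (Finset.mem_range.1 hj)
      · intro h
        apply hx₁P
        rw [← h]
        exact hp
    · rintro (_ | v) hx hx' i
      · rw [map_mul, map_zpow₀, val_none_sub_C, val_none_poleFun q (hJ i), inftyEquation, map_zpow₀,
          val_none_X, ← exp_zsmul, ← exp_zsmul, ← exp_add, exp_inj, hn, smul_eq_mul, smul_eq_mul]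
        ring
      · rw [map_mul, map_zpow₀, val_sub_C_eq_one fun h => hx' (congrArg some h), one_zpow, one_mul,
          hnotP hx, inftyEquation, map_one]
    · intro i
      rw [map_mul, (isParam_pt a).val_zpow, hnotP hx₁P, inftyEquation, map_one]

end Functions

/-- The trivial bundle with a given frame. -/
def VecBundle.ofBasis {K : Type*} [Field K] {V : Type*} [AddCommGroup V] [Module (RatFunc K) V]
    (b : Module.Basis (Fin (Module.finrank (RatFunc K) V)) (RatFunc K) V) : VecBundle K V where
  stalk x := Submodule.span (localRing x) (Set.range b)
  locallyFree _ := ⟨b, rfl⟩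
  coherent := ⟨b, by simp⟩

end

end P1Conn

/-! ### Assembly of the trivial bundle and verification point by point -/

theorem theorem2p1 {k K : Type*} [Field k] [CharZero k] [Field K] [Algebra k K]
    [Algebra.EssFiniteType k K]
    {V : Type*} [AddCommGroup V] [Module (RatFunc K) V] [FiniteDimensional (RatFunc K) V]
    (E : P1Conn.VecBundle K V) (N : P1Conn.Connection k K V) (𝒟 : P1Conn.EffDivisor K)
    (hE : P1Conn.IsAdmissible E N 𝒟) (hD : ∃ x, 2 ≤ 𝒟 x) :
    ∃ P : Finset (P1Conn.ClosedPoint K),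
      (∀ p ∈ P, P1Conn.IsRational p ∧ 𝒟 p = 0) ∧
      ∃ (𝒟' : P1Conn.EffDivisor K) (L : P1Conn.VecBundle K V),
        𝒟' = 𝒟 + ∑ p ∈ P, Finsupp.single p 1 ∧
        L.IsTrivial ∧
        (∀ x, 𝒟' x = 0 → L.stalk x = E.stalk x) ∧
        P1Conn.IsSpecialPseudoAdmissible L N 𝒟' ∧
        P1Conn.IsDeRhamQuasiIso L E N 𝒟' := by
  classical
  open P1Conn WithZero in
  have : CharZero K := charZero_of_injective_algebraMap (algebraMap k K).injective
  obtain ⟨x₁, hx₁⟩ := hD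
  have hx₁rat := hE.rational x₁ (by omega)
  obtain ⟨b, d, hfin, hinf⟩ := E.exists_splitting
  obtain ⟨P, h, c, hh0, hP, hout, hx₁h⟩ := exists_balancing d 𝒟 hx₁rat (by omega : 𝒟 x₁ ≠ 0)
  have hEmem : ∀ x v, v ∈ E.stalk x ↔ ∀ i, val x (b.repr v i) ≤ val x (inftyEquation (d i) x) := by
    rintro (_ | w) v
    · rw [hinf, mem_span_scale_iff]
      rfl
    · rw [hfin, mem_span_basis_iff]
      simp [inftyEquation]
  set L := VecBundle.ofBasis (scale b h hh0) with hLdef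
  have hLmem : ∀ x v, v ∈ L.stalk x ↔ ∀ i, val x (b.repr v i) ≤ val x (h i) := fun x v =>
    mem_span_scale_iff b h hh0
  have hLE : ∀ x ∉ P, x ≠ x₁ → L.stalk x = E.stalk x := by
    intro x hxP hx
    ext v
    rw [hLmem, hEmem]
    simp_rw [hout x hxP hx]
  have hx₁P : x₁ ∉ P := fun hp => by
    have := (hP x₁ hp).1
    omega
  obtain ⟨𝒟', h𝒟'⟩ : ∃ 𝒟' : EffDivisor K, 𝒟' = 𝒟 + ∑ p ∈ P, Finsupp.single p 1 := ⟨_, rfl⟩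
  have h𝒟P : ∀ p ∈ P, 𝒟' p = 1 := by
    intro p hp
    rw [h𝒟', Finsupp.add_apply, (hP p hp).1, Finsupp.finsetSum_apply]
    simp [Finsupp.single_apply, hp]
  have h𝒟out : ∀ x ∉ P, 𝒟' x = 𝒟 x := by
    intro x hx
    rw [h𝒟', Finsupp.add_apply, Finsupp.finsetSum_apply]
    simp [Finsupp.single_apply, hx]
  have hLE0 : ∀ x, 𝒟' x = 0 → 𝒟 x = 0 ∧ L.stalk x = E.stalk x := by
    intro x hx
    have hxP : x ∉ P := fun hp => by have := h𝒟P x hp; omega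
    rw [h𝒟out x hxP] at hx
    exact ⟨hx, hLE x hxP (by rintro rfl; omega)⟩
  have hadm : ∀ x ∉ P, 𝒟 x ≠ 0 → IsAdmissibleAt L N x (𝒟 x) := by
    intro x hxP hx
    rcases eq_or_ne x x₁ with rfl | hne
    · obtain ⟨z, hz⟩ := hx₁rat.exists_isCoord
      -- At `x₁` the functions `hᵢ` differ from the local equations of `E` by one common order `c`,
      -- so `L` is a twist of `E` there.
      refine (hE.admissible x hx).twist hx₁ hz (c := c) fun v => ?_
      rw [hLmem, hEmem]
      refine forall_congr' fun i => ?_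
      rw [map_smul, Finsupp.smul_apply, smul_eq_mul, map_mul, hz.isParam.val_zpow, hx₁h, exp_neg,
        inv_mul_le_iff₀ (by simp [zero_lt_iff])]
    · have := hE.admissible x hx
      have e := hLE x hxP hne
      -- Admissibility depends on the bundle only through its stalk at `x`.
      simpa only [IsAdmissibleAt, HasPolesAt, PolarPartIso, DeligneCondition, relForms, e] using this
  have hspecial : ∀ p ∈ P, IsRational p ∧ IsSpecialPseudoLogAt L N p ∧ ∃ (z : RatFunc K)
      (hz : IsCoord p z), (∀ e ∈ L.stalk p, z ^ ((1 : ℕ) : ℤ) • N.along hz e ∈ L.stalk p) ∧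
        ∀ n : ℕ, N.InjModAt hz (L.stalk p) 1 n := by
    intro p hp
    obtain ⟨hp0, ⟨a, rfl⟩, hval⟩ := hP p hp
    have hz := isCoord_pt a
    choose e he he' using fun i => show ∃ e : ℤ, (e = -1 ∨ e = -2) ∧
        val (some (pt a)) (h i) = exp (-e) from by
      rcases hval i with h1 | h1
      · exact ⟨-1, Or.inl rfl, h1⟩
      · exact ⟨-2, Or.inr rfl, h1⟩
    obtain ⟨h1, h2, h3⟩ := isSpecialPseudoLogAt_of_regular (L := L) (hE.regular _ hp0) hz
      (hfin _) he (by
      ext v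
      rw [hLmem, mem_span_scale_iff]
      simp_rw [he', hz.isParam.val_zpow])
    exact ⟨hz.isRational, h1, _, hz, h2, h3⟩
  refine ⟨P, fun p hp => ⟨(hspecial p hp).1, (hP p hp).1⟩, 𝒟', L, h𝒟', ⟨_, fun _ => rfl⟩,
    fun x hx => (hLE0 x hx).2, ?_, ?_⟩
  · have hrat : ∀ x, 𝒟' x ≠ 0 → IsRational x := by
      intro x hx
      by_cases hxP : x ∈ P
      · exact (hspecial x hxP).1
      · exact hE.rational x (h𝒟out x hxP ▸ hx)
    refine { rational := hrat, regular := ?_, vertical := ?_, admissible := ?_, pseudoLog := ?_,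
             special := ?_ }
    · intro x hx
      have := hE.regular x (hLE0 x hx).1
      simpa only [HasPolesAt, (hLE0 x hx).2] using this
    · intro x hx
      rw [(hLE0 x hx).2]
      exact hE.vertical x (hLE0 x hx).1
    · intro x hx
      have hxP : x ∉ P := fun hp => by have := h𝒟P x hp; omega
      rw [h𝒟out x hxP] at hx ⊢
      exact hadm x hxP (by omega)
    · intro x hx
      by_cases hxP : x ∈ P
      · exact (hspecial x hxP).2.1.1
      · have h1 := hadm x hxP (by rw [← h𝒟out x hxP]; omega)
        rw [← h𝒟out x hxP, hx] at h1
        exact h1.isPseudoLogAt (hrat x (by omega))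
    · intro x hx
      by_cases hxP : x ∈ P
      · exact Or.inr (hspecial x hxP).2.1
      · have h1 := hadm x hxP (by rw [← h𝒟out x hxP]; omega)
        rw [← h𝒟out x hxP, hx] at h1
        exact Or.inl h1
  · intro x
    have hpush₀ : ∀ v, v ∈ pushStalk {y | 𝒟' y = 0} (fun y => (E.stalk y).toAddSubgroup) x ↔
        (𝒟' x = 0 → v ∈ E.stalk x) := fun v => mem_pushStalk_iff (E.finite_notMem v)
    have hpush₁ : ∀ ξ, ξ ∈ pushStalk {y | 𝒟' y = 0} (fun y => (relForms E y 0).toAddSubgroup) x ↔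
        (𝒟' x = 0 → ξ ∈ relForms E x 0) := fun ξ => mem_pushStalk_iff (E.finite_notMem_relForms ξ)
    by_cases hx : 𝒟' x = 0
    · obtain ⟨hx0, e⟩ := hLE0 x hx
      have e₀ : pushStalk {y | 𝒟' y = 0} (fun y => (E.stalk y).toAddSubgroup) x =
          (E.stalk x).toAddSubgroup := by
        ext v
        rw [hpush₀]
        exact ⟨fun h => h hx, fun h _ => h⟩
      have e₁ : pushStalk {y | 𝒟' y = 0} (fun y => (relForms E y 0).toAddSubgroup) x =
          (relForms E x 0).toAddSubgroup := by
        ext v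
        rw [hpush₁]
        exact ⟨fun h => h hx, fun h _ => h⟩
      have e₂ : relForms L x 0 = relForms E x 0 := by rw [relForms, relForms, e]
      rw [e₀, e₁, hx, e₂, e]
      exact isQuasiIsoInclusion_self fun v hv => (hE.regular x hx0).rel_mem hv
    -- At a singular point no condition remains, so both direct images have the whole generic space
    -- as stalk and the local criterion applies.
    · have e₀ : pushStalk {y | 𝒟' y = 0} (fun y => (E.stalk y).toAddSubgroup) x = ⊤ :=
        eq_top_iff.2 fun v _ => (hpush₀ v).2 fun h => absurd h hx
      have e₁ : pushStalk {y | 𝒟' y = 0} (fun y => (relForms E y 0).toAddSubgroup) x = ⊤ :=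
        eq_top_iff.2 fun v _ => (hpush₁ v).2 fun h => absurd h hx
      rw [e₀, e₁]
      by_cases hxP : x ∈ P
      · obtain ⟨-, -, z, hz, hS, hinj⟩ := hspecial x hxP
        rw [h𝒟P x hxP]
        exact isQuasiIsoInclusion_of_injModAt hz one_ne_zero hS fun n => by
          simpa using hinj (n + 1)
      · rw [h𝒟out x hxP] at hx ⊢
        obtain ⟨z, hz⟩ := (hE.rational x hx).exists_isCoord
        have h1 := hadm x hxP hx
        exact isQuasiIsoInclusion_of_injModAt hz hx (h1.1.along_mem hz) fun n => by
          simpa using h1.injModAt hx hz (n + 1)
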